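/- Let $\kappa_1,\kappa_2\in\mathbb{R}$ and let $\mathcal{T}_{\kappa_1\kappa_2}$ be the map of the cylinder $\mathbb{T}\times\mathbb{R}$, $\mathbb{T}=\mathbb{R}/\mathbb{Z}$, given by $$\mathcal{T}_{\kappa_1\kappa_2}(x,y)=\bigl(x+2y+\mathcal{F}_1(x,y) \bmod 1,\; y+\mathcal{F}_2(x,y)\bigr),$$ $$\mathcal{F}_2(x,y)=\tfrac{\kappa_1}{2\pi}\sin(2\pi x)+\tfrac{\kappa_2}{2\pi}\sin\Bigl(2\pi\bigl[x+y+\tfrac{\kappa_1}{2\pi}\sin(2\pi x)\bigr]\Bigr),\qquad \mathcal{F}_1(x,y)=\tfrac{\kappa_1}{2\pi}\sin(2\pi x)+\mathcal{F}_2(x,y).$$ An essential invariant circle of $\mathcal{T}_{\kappa_1\kappa_2}$ is a simple closed curve $C\subset\mathbb{T}\times\mathbb{R}$ that is not homotopic to a point and satisfies $\mathcal{T}_{\kappa_1\kappa_2}(C)=C$; its amplitude is $\max_{(x,y)\in C}y-\min_{(x,y)\in C}y$. Write $(x_n,y_n)=\mathcal{T}_{\kappa_1\kappa_2}^n(x_0,y_0)$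 for $n\ge 0$. Suppose that every essential invariant circle of $\mathcal{T}_{\kappa_1\kappa_2}$ has amplitude less than $1$ (in particular, this holds if all invariant circles do), and that there are an initial condition $(x_0,y_0)$ with $y_0\in(0,1)$ and an $n\ge 0$ such that $|y_n-y_0|>2$. Then $\mathcal{T}_{\kappa_1\kappa_2}$ has no essential invariant circle, and it has global transport: there is an initial condition whose orbit $(x_n,y_n)_{n\ge0}$ has an unbounded sequence $(y_n)_{n\ge 0}$. -/

import Mathlib

noncomputable section

namespace NASM

/-- The cylinder `𝕋 × ℝ`, where `𝕋 = ℝ / ℤ`. -/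
abbrev Cylinder : Type := UnitAddCircle × ℝ

theorem periodic_sin_two_pi :
    Function.Periodic (fun x : ℝ => Real.sin (2 * Real.pi * x)) 1 := by
  intro x
  simp only [mul_add, mul_one, Real.sin_add_two_pi]

/-- The function `x ↦ sin (2πx)` on the circle `ℝ / ℤ`. -/
def sinTwoPi (x : UnitAddCircle) : ℝ := periodic_sin_two_pi.lift x

/-- `ℱ₂(x,y;κ₁,κ₂) = κ₁/(2π) sin (2πx) + κ₂/(2π) sin (2π(x + y + κ₁/(2π) sin (2πx)))`. -/
def F₂ (κ₁ κ₂ : ℝ) (z : Cylinder) : ℝ :=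
  κ₁ / (2 * Real.pi) * sinTwoPi z.1 +
    κ₂ / (2 * Real.pi) *
      sinTwoPi (z.1 + ((z.2 + κ₁ / (2 * Real.pi) * sinTwoPi z.1 : ℝ) : UnitAddCircle))

/-- `ℱ₁(x,y;κ₁,κ₂) = κ₁/(2π) sin (2πx) + ℱ₂(x,y;κ₁,κ₂)`. -/
def F₁ (κ₁ κ₂ : ℝ) (z : Cylinder) : ℝ :=
  κ₁ / (2 * Real.pi) * sinTwoPi z.1 + F₂ κ₁ κ₂ z

/-- The map `𝒯_{κ₁κ₂}(x, y) = (x + 2y + ℱ₁ mod 1, y + ℱ₂)` of the cylinder. -/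
def T (κ₁ κ₂ : ℝ) (z : Cylinder) : Cylinder :=
  (z.1 + ((2 * z.2 + F₁ κ₁ κ₂ z : ℝ) : UnitAddCircle), z.2 + F₂ κ₁ κ₂ z)

/-- The standard map
`𝒮_ε(x, y) = (x + y + ε/(2π) sin (2πx) mod 1, y + ε/(2π) sin (2πx))` of the cylinder. -/
def standardMap (ε : ℝ) (z : Cylinder) : Cylinder :=
  (z.1 + ((z.2 + ε / (2 * Real.pi) * sinTwoPi z.1 : ℝ) : UnitAddCircle),
    z.2 + ε / (2 * Real.pi) * sinTwoPi z.1)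

theorem T_eq_standardMap_comp (κ₁ κ₂ : ℝ) :
    T κ₁ κ₂ = standardMap κ₂ ∘ standardMap κ₁ := by
  funext z
  refine Prod.ext ?_ ?_
  · simp only [T, F₁, F₂, standardMap, Function.comp_apply]
    rw [add_assoc z.1, ← AddCircle.coe_add]
    congr 2
    ring
  · simp only [T, F₂, standardMap, Function.comp_apply]
    ring

/-- `C` is an essential invariant circle of `f`: a simple closed curve in the cylinder which is
not homotopic to a point and which is mapped onto itself by `f`. -/
def IsEssentialInvariantCircle (f : Cylinder → Cylinder) (C : Set Cylinder) : Prop :=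
  (∃ γ : C(UnitAddCircle, Cylinder),
    Function.Injective γ ∧ Set.range γ = C ∧ ¬ γ.Nullhomotopic) ∧ f '' C = C

/-- The amplitude of a circle in the cylinder: the difference between the heights of its highest
and of its lowest point. -/
def amplitude (C : Set Cylinder) : ℝ :=
  sSup (Prod.snd '' C) - sInf (Prod.snd '' C)

/-- The map `f` of the cylinder has global transport: the `y` variable is unbounded along the
(forward) orbit of at least one initial condition. -/
def HasGlobalTransport (f : Cylinder → Cylinder) : Prop :=
  ∃ z : Cylinder, ¬ Bornology.IsBounded (Set.range fun n : ℕ => (f^[n] z).2)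

end NASM

end

/-! The two conclusions are independent of each other. Confinement: an essential circle `C`
separates the bottom of the cylinder from the top, and `T` is injective and preserves `C`, so an
orbit starting above `C` never gets entirely below it, and conversely. Since `T` commutes with
integer vertical translations, any initial point can be shifted to lie just above or just below `C`.
With amplitude less than 1 its height then changes by at most 2 (`abs_iterate_snd_sub_le`), which
the given orbit contradicts.

Transport follows from the absence of circles alone, by weak KAM theory with pseudographs. A
semiconcave function `v` with `v (x + 1) = v x + c` is a potential of mean slope `c`; its
differential, `graph v`, lies within 1/2 of height `c`. Each standard map has the generating
function `(x' - x)^2/2 + V x`. Minimizing `v x + V x + (x' - x)^2/2` over `x` gives a new potential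
whose differential lies in the image of `graph v` (`graph_envelope_subset`).

Consider the supremum `s` of the mean slopes reachable from `v₀` by such moves. If `s` is finite,
weak KAM fixed points (`exists_weakKAM`) and compactness give a potential of slope `s`, fixed up to
a constant and a limit of reachable ones. If every point is a minimizer in both half steps, this
potential is C¹ and its differential is an essential invariant circle. Otherwise some `a` is never a
minimizer. A small upward jump inserted at `a` then goes unnoticed by the dynamics but raises the
slope (`eventually_graph_envelope_subset`), so a slope beyond `s` is reached. Hence the slopes are
unbounded, and a nested compactness argument (`exists_orbit_of_reaches`) yields one orbit that
follows them. -/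

open Topology Filter Set

namespace NASM

/-! ### Topology of the cylinder: an essential loop separates bottom from top. -/

/-- A continuous integer-valued real function on a connected space is constant. -/
theorem const_of_forall_int {X : Type*} [TopologicalSpace X] [PreconnectedSpace X]
    {f : X → ℝ} (hf : Continuous f) (h : ∀ x, ∃ n : ℤ, f x = n) (x y : X) : f x = f y := by
  choose n hn using h
  have hn' : Continuous n := by
    rw [Int.isClosedEmbedding_coe_real.isEmbedding.continuous_iff]
    exact hf.congr hn
  rw [hn, hn, PreconnectedSpace.constant inferInstance hn']

/-- A continuous nowhere vanishing complex function on the plane has a continuous logarithm. -/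
theorem exists_continuous_log {F : ℝ × ℝ → ℂ} (hF : Continuous F) (h0 : ∀ z, F z ≠ 0) :
    ∃ L : ℝ × ℝ → ℂ, Continuous L ∧ ∀ z, Complex.exp (L z) = F z := by
  let f : C(ℝ × ℝ, {z : ℂ // z ≠ 0}) := ⟨fun z => ⟨F z, h0 z⟩, by fun_prop⟩
  obtain ⟨L, ⟨-, hL⟩, -⟩ := Complex.isCoveringMap_exp.existsUnique_continuousMap_lifts f (0, 0)
    (Complex.log (F (0, 0))) (Subtype.ext (Complex.exp_log (h0 _)))
  exact ⟨L, L.continuous, fun z => congrArg Subtype.val (congrFun hL z)⟩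

theorem exp_eq_exp_int {a b : ℂ} (h : Complex.exp a = Complex.exp b) :
    ∃ n : ℤ, (a - b) / (2 * Real.pi * Complex.I) = n := by
  obtain ⟨n, hn⟩ := Complex.exp_eq_exp_iff_exists_int.1 h
  refine ⟨n, ?_⟩
  rw [hn]
  field_simp
  ring

/-- Two continuous logarithms of one function differ by a locally constant multiple of `2πi`. -/
theorem const_of_exp_eq_exp {X : Type*} [TopologicalSpace X] [PreconnectedSpace X]
    {f g : X → ℂ} (hf : Continuous f) (hg : Continuous g)
    (h : ∀ x, Complex.exp (f x) = Complex.exp (g x)) (x y : X) : f x - g x = f y - g y := by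
  have key : ∀ x, ∃ n : ℤ, (f x - g x) / (2 * Real.pi * Complex.I) = n :=
    fun x => exp_eq_exp_int (h x)
  have hc := const_of_forall_int
    (f := fun x => ((f x - g x) / (2 * Real.pi * Complex.I)).re) (by fun_prop)
    (fun x => (key x).imp fun n hn => by rw [hn]; simp) x y
  obtain ⟨n, hn⟩ := key x
  obtain ⟨m, hm⟩ := key y
  simp only [hn, hm, Complex.intCast_re, Int.cast_inj] at hc
  subst hc
  have h0 : (2 * Real.pi * Complex.I : ℂ) ≠ 0 := by simp [Real.pi_ne_zero]
  rw [div_eq_iff h0] at hn hm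
  rw [hn, hm]

/-- A path crossing the cylinder from below a curve of nonzero degree to above it meets it. -/
theorem exists_crossing {g h p q : ℝ → ℝ} (hg : Continuous g) (hh : Continuous h)
    (hp : Continuous p) (hq : Continuous q) {d : ℤ} (hd : d ≠ 0) (hgd : ∀ t, g (t + 1) = g t + d)
    (hh1 : ∀ t, h (t + 1) = h t) {a b : ℝ} (ha : ∀ t, q a < h t) (hb : ∀ t, h t < q b) :
    ∃ t s : ℝ, ∃ n : ℤ, g t - p s = n ∧ h t = q s := by
  by_contra hcon
  push Not at hcon
  -- `exp E = 1` exactly where the curve and the path meet modulo 1. Without a meeting, `exp E - 1`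
  -- has a continuous logarithm `L` on the plane, whose increment over one period of the curve
  -- cannot depend on the path parameter.
  set E : ℝ × ℝ → ℂ := fun z =>
    2 * Real.pi * Complex.I * ((g z.1 - p z.2 : ℝ) + (h z.1 - q z.2 : ℝ) * Complex.I) with hE
  have hEc : Continuous E := by fun_prop
  have hEre : ∀ z, (E z).re = -(2 * Real.pi * (h z.1 - q z.2)) := by
    intro z
    simp [hE]
  have hF0 : ∀ z, Complex.exp (E z) - 1 ≠ 0 := by
    intro z hz
    rw [sub_eq_zero, Complex.exp_eq_one_iff] at hz
    obtain ⟨n, hn⟩ := hz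
    have h0 : (2 * Real.pi * Complex.I : ℂ) ≠ 0 := by simp [Real.pi_ne_zero]
    have hn := mul_left_cancel₀ h0 (hn.trans (mul_comm _ _))
    have h1 := congrArg Complex.re hn
    have h2 := congrArg Complex.im hn
    simp only [Complex.add_re, Complex.ofReal_re, Complex.mul_re, Complex.I_re, mul_zero,
      Complex.ofReal_im, Complex.I_im, mul_one, sub_self, add_zero, Complex.intCast_re] at h1
    simp only [Complex.add_im, Complex.ofReal_im, Complex.mul_im, Complex.I_im, mul_one,
      Complex.ofReal_re, Complex.I_re, mul_zero, add_zero, zero_add, Complex.intCast_im] at h2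
    exact hcon _ _ n h1 (by linarith)
  obtain ⟨L, hL, hLF⟩ := exists_continuous_log
    (F := fun z => Complex.exp (E z) - 1) (by fun_prop) hF0
  have hE1 : ∀ t s, E (t + 1, s) = E (t, s) + 2 * Real.pi * Complex.I * d := by
    intro t s
    simp only [hE, hgd, hh1]
    push_cast
    ring
  have hexp1 : ∀ t s, Complex.exp (E (t + 1, s)) = Complex.exp (E (t, s)) := by
    intro t s
    rw [hE1, Complex.exp_eq_exp_iff_exists_int]
    exact ⟨d, by ring⟩
  have hper := const_of_exp_eq_exp (f := fun z : ℝ × ℝ => L (z.1 + 1, z.2)) (g := L)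
    (by fun_prop) hL (fun z => by rw [hLF, hLF, hexp1])
  -- At `b` the curve lies below the path, so `|exp E| > 1` and `L` equals `E` plus a periodic term
  -- up to a constant: the increment is that of `E`. At `a` one has `|exp E| < 1`, so `exp E - 1`
  -- stays near `-1` and does not wind.
  have hlow : L (0 + 1, b) - L (0, b) = 2 * Real.pi * Complex.I * d := by
    have hlt : ∀ t, ‖Complex.exp (-E (t, b))‖ < 1 := by
      intro t
      rw [Complex.norm_exp, Real.exp_lt_one_iff, Complex.neg_re, hEre]
      have := mul_pos Real.two_pi_pos (sub_pos.2 (hb t))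
      simp only
      linarith
    have hslit : ∀ t, 1 - Complex.exp (-E (t, b)) ∈ Complex.slitPlane := by
      intro t
      left
      have := (Complex.re_le_norm (Complex.exp (-E (t, b)))).trans_lt (hlt t)
      simp only [Complex.sub_re, Complex.one_re]
      linarith
    have := const_of_exp_eq_exp (f := fun t : ℝ => L (t, b))
      (g := fun t => E (t, b) + Complex.log (1 - Complex.exp (-E (t, b)))) (by fun_prop)
      ((by fun_prop : Continuous fun t => E (t, b)).add
        (Continuous.clog (by fun_prop) hslit)) (fun t => by
        rw [hLF, Complex.exp_add, Complex.exp_log (Complex.slitPlane_ne_zero (hslit t)), mul_sub,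
          ← Complex.exp_add]
        simp) (0 + 1) 0
    simp only [Complex.exp_neg, hexp1] at this
    rw [hE1] at this
    linear_combination this
  have hhigh : L (0 + 1, a) - L (0, a) = 0 := by
    have hlt : ∀ t, ‖Complex.exp (E (t, a))‖ < 1 := by
      intro t
      rw [Complex.norm_exp, Real.exp_lt_one_iff, hEre]
      have := mul_pos Real.two_pi_pos (sub_pos.2 (ha t))
      simp only
      linarith
    have hslit : ∀ t, 1 - Complex.exp (E (t, a)) ∈ Complex.slitPlane := by
      intro t
      left
      have := (Complex.re_le_norm (Complex.exp (E (t, a)))).trans_lt (hlt t)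
      simp only [Complex.sub_re, Complex.one_re]
      linarith
    have := const_of_exp_eq_exp (f := fun t : ℝ => L (t, a))
      (g := fun t => Real.pi * Complex.I + Complex.log (1 - Complex.exp (E (t, a)))) (by fun_prop)
      (continuous_const.add (Continuous.clog (by fun_prop) hslit)) (fun t => by
        rw [hLF, Complex.exp_add, Complex.exp_log (Complex.slitPlane_ne_zero (hslit t)),
          Complex.exp_pi_mul_I]
        ring) (0 + 1) 0
    simp only [hexp1] at this
    linear_combination this
  have h3 := hper (0, a) (0, b)
  simp only at h3
  rw [hlow, hhigh] at h3
  have : (2 * Real.pi * Complex.I * d : ℂ) ≠ 0 := by simp [Real.pi_ne_zero, hd]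
  exact this h3.symm

section

theorem coe_eq_coe_iff_exists_int {x y : ℝ} :
    (x : UnitAddCircle) = (y : UnitAddCircle) ↔ ∃ n : ℤ, x - y = n := by
  rw [← sub_eq_zero, ← AddCircle.coe_sub, AddCircle.coe_eq_zero_iff]
  simp [eq_comm]

theorem coe_add_one (x : ℝ) : ((x + 1 : ℝ) : UnitAddCircle) = (x : UnitAddCircle) :=
  coe_eq_coe_iff_exists_int.2 ⟨1, by simp⟩

theorem exists_continuous_lift {f : ℝ → UnitAddCircle} (hf : Continuous f) :
    ∃ g : ℝ → ℝ, Continuous g ∧ ∀ t, (g t : UnitAddCircle) = f t := by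
  obtain ⟨x, hx⟩ := QuotientAddGroup.mk_surjective (f 0)
  obtain ⟨g, ⟨-, hg⟩, -⟩ := (AddCircle.isCoveringMap_coe (1 : ℝ)).existsUnique_continuousMap_lifts
    ⟨f, hf⟩ 0 x hx
  exact ⟨g, g.continuous, fun t => congrFun hg t⟩

theorem continuous_periodic_lift {Y : Type*} [TopologicalSpace Y] {f : ℝ → Y}
    (hf : Continuous f) (hp : Function.Periodic f 1) :
    Continuous (hp.lift : UnitAddCircle → Y) :=
  (QuotientAddGroup.isQuotientMap_mk _).continuous_iff.2 (hf.congr fun x => (hp.lift_coe x).symm)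

/-- An essential loop in the cylinder lifts to a curve in the plane which winds around. -/
theorem exists_lift_of_not_nullhomotopic {γ : C(UnitAddCircle, Cylinder)}
    (hγ : ¬ γ.Nullhomotopic) :
    ∃ (g h : ℝ → ℝ) (d : ℤ), Continuous g ∧ Continuous h ∧ d ≠ 0 ∧ (∀ t, g (t + 1) = g t + d) ∧
      (∀ t, h (t + 1) = h t) ∧ ∀ t : ℝ, γ t = ((g t : UnitAddCircle), h t) := by
  have hc : Continuous fun t : ℝ => γ (t : UnitAddCircle) :=
    γ.continuous.comp (AddCircle.continuous_mk' 1)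
  obtain ⟨g, hg, hgγ⟩ := exists_continuous_lift (continuous_fst.comp hc)
  have hint : ∀ t, ∃ n : ℤ, g (t + 1) - g t = n := by
    intro t
    rw [← coe_eq_coe_iff_exists_int, hgγ, hgγ]
    simp only [Function.comp_apply, coe_add_one]
  have hconst := const_of_forall_int (f := fun t => g (t + 1) - g t) (by fun_prop) hint
  obtain ⟨d, hd⟩ := hint 0
  have hgd : ∀ t, g (t + 1) = g t + d := fun t => by linarith [hconst t 0]
  refine ⟨g, fun t => (γ t).2, d, hg, continuous_snd.comp hc, ?_, hgd,
    fun t => by simp only [coe_add_one], fun t => Prod.ext (hgγ t).symm rfl⟩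
  -- In degree 0 the lift is itself periodic, so the loop factors through the contractible plane.
  rintro rfl
  apply hγ
  have hgp : Function.Periodic g 1 := fun t => by simpa using hgd t
  let G : C(UnitAddCircle, ℝ × ℝ) :=
    ⟨fun x => (hgp.lift x, (γ x).2), (continuous_periodic_lift hg hgp).prodMk (by fun_prop)⟩
  let P : C(ℝ × ℝ, Cylinder) :=
    ⟨fun z => ((z.1 : UnitAddCircle), z.2),
      ((AddCircle.continuous_mk' 1).comp continuous_fst).prodMk continuous_snd⟩
  have hG : γ = P.comp ((ContinuousMap.id (ℝ × ℝ)).comp G) := by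
    ext1 x
    induction x using QuotientAddGroup.induction_on with
    | H t =>
      refine Prod.ext ?_ rfl
      change _ = ((hgp.lift (t : UnitAddCircle) : ℝ) : UnitAddCircle)
      rw [hgp.lift_coe, hgγ]
      rfl
  rw [hG]
  exact ((id_nullhomotopic (ℝ × ℝ)).comp_left G).comp_right P

/-- The complement of an essential loop does not join the part of the cylinder below the loop to
the part above it. -/
theorem not_joinedIn_compl_range {γ : C(UnitAddCircle, Cylinder)} (hγ : ¬ γ.Nullhomotopic)
    {z w : Cylinder} (hz : ∀ p ∈ range γ, z.2 < p.2) (hw : ∀ p ∈ range γ, p.2 < w.2) :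
    ¬ JoinedIn (range γ)ᶜ z w := by
  rintro ⟨δ, hδ⟩
  obtain ⟨g, h, d, hg, hh, hd, hgd, hh1, hγe⟩ := exists_lift_of_not_nullhomotopic hγ
  have hγh : ∀ t : ℝ, (γ t).2 = h t := fun t => by rw [hγe]
  obtain ⟨p, hp, hpδ⟩ := exists_continuous_lift (continuous_fst.comp δ.extend.continuous)
  obtain ⟨t, s, n, h1, h2⟩ := exists_crossing hg hh hp
    (continuous_snd.comp δ.extend.continuous) hd hgd hh1 (a := 0) (b := 1)
    (fun t => by simpa [hγh] using hz _ (mem_range_self (t : UnitAddCircle)))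
    (fun t => by simpa [hγh] using hw _ (mem_range_self (t : UnitAddCircle)))
  refine hδ (projIcc 0 1 zero_le_one s) ⟨(t : UnitAddCircle), ?_⟩
  have : δ (projIcc 0 1 zero_le_one s) = δ.extend s := rfl
  rw [this, hγe]
  refine Prod.ext ?_ h2
  rw [coe_eq_coe_iff_exists_int.2 ⟨n, h1⟩, hpδ]
  rfl

/-- The iterates of `z` need not stay in `A`, but they stay in its path component of `Cᶜ`: one point
of `A` with image in `A` suffices to carry a connecting path from each step to the next. -/
theorem joinedIn_iterate {f : Cylinder → Cylinder} (hf : Continuous f) {C A : Set Cylinder}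
    (hC : MapsTo f Cᶜ Cᶜ) (hA : IsPathConnected A) (hAC : A ⊆ Cᶜ) (hfA : ∃ w ∈ A, f w ∈ A)
    {z : Cylinder} (hz : z ∈ A) (n : ℕ) : ∃ w ∈ A, JoinedIn Cᶜ (f^[n] z) w := by
  obtain ⟨u, hu, hfu⟩ := hfA
  induction n with
  | zero => exact ⟨z, hz, .refl (hAC hz)⟩
  | succ n ih =>
    obtain ⟨w, hw, hj⟩ := ih
    have hj' := (hj.trans ((hA.joinedIn w hw u hu).mono hAC)).map hf
    rw [Function.iterate_succ_apply']
    exact ⟨f u, hfu, hj'.mono (image_subset_iff.2 hC)⟩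

theorem isPathConnected_height {S : Set ℝ} (hS : S.OrdConnected) (hne : S.Nonempty) :
    IsPathConnected {z : Cylinder | z.2 ∈ S} := by
  have := (isPathConnected_univ (X := UnitAddCircle)).prod (hS.convex.isPathConnected hne)
  convert this using 1
  ext
  simp

/-! ### Confinement of orbits by an essential invariant circle. -/

theorem continuous_sinTwoPi : Continuous sinTwoPi :=
  continuous_periodic_lift (by fun_prop) periodic_sin_two_pi

@[simp]
theorem sinTwoPi_coe (x : ℝ) : sinTwoPi (x : UnitAddCircle) = Real.sin (2 * Real.pi * x) :=
  periodic_sin_two_pi.lift_coe x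

theorem abs_sinTwoPi_le (x : UnitAddCircle) : |sinTwoPi x| ≤ 1 := by
  induction x using QuotientAddGroup.induction_on with
  | H t => exact (congrArg abs (sinTwoPi_coe t)).trans_le (Real.abs_sin_le_one _)

theorem continuous_standardMap (ε : ℝ) : Continuous (standardMap ε) := by
  have := continuous_sinTwoPi
  have h : Continuous fun z : Cylinder => z.2 + ε / (2 * Real.pi) * sinTwoPi z.1 := by fun_prop
  exact (continuous_fst.add ((AddCircle.continuous_mk' 1).comp h)).prodMk h

theorem standardMap_injective (ε : ℝ) : Function.Injective (standardMap ε) := by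
  rintro ⟨x, y⟩ ⟨x', y'⟩ h
  have h2 : y + ε / (2 * Real.pi) * sinTwoPi x = y' + ε / (2 * Real.pi) * sinTwoPi x' :=
    congrArg Prod.snd h
  have h1 : x + ((y + ε / (2 * Real.pi) * sinTwoPi x : ℝ) : UnitAddCircle) =
      x' + ((y' + ε / (2 * Real.pi) * sinTwoPi x' : ℝ) : UnitAddCircle) := congrArg Prod.fst h
  rw [h2, add_left_inj] at h1
  subst h1
  simpa using h2

theorem abs_standardMap_snd_sub_le (ε : ℝ) (z : Cylinder) :
    |(standardMap ε z).2 - z.2| ≤ |ε / (2 * Real.pi)| := by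
  simp only [standardMap, add_sub_cancel_left, abs_mul]
  exact mul_le_of_le_one_right (abs_nonneg _) (abs_sinTwoPi_le _)

/-- The vertical translation of the cylinder. -/
def shift (k : ℤ) (z : Cylinder) : Cylinder := (z.1, z.2 + k)

theorem standardMap_shift (ε : ℝ) (k : ℤ) :
    Function.Commute (standardMap ε) (shift k) := by
  intro z
  refine Prod.ext ?_ ?_
  · simp only [standardMap, shift, add_right_inj]
    exact coe_eq_coe_iff_exists_int.2 ⟨k, by ring⟩
  · simp only [standardMap, shift]
    ring

variable (κ₁ κ₂ : ℝ)

theorem continuous_T : Continuous (T κ₁ κ₂) := by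
  rw [T_eq_standardMap_comp]
  exact (continuous_standardMap _).comp (continuous_standardMap _)

theorem T_injective : Function.Injective (T κ₁ κ₂) := by
  rw [T_eq_standardMap_comp]
  exact (standardMap_injective _).comp (standardMap_injective _)

theorem abs_T_snd_sub_le (z : Cylinder) :
    |(T κ₁ κ₂ z).2 - z.2| ≤ |κ₁ / (2 * Real.pi)| + |κ₂ / (2 * Real.pi)| := by
  rw [T_eq_standardMap_comp]
  have h1 := abs_standardMap_snd_sub_le κ₁ z
  have h2 := abs_standardMap_snd_sub_le κ₂ (standardMap κ₁ z)
  calc _ = |((standardMap κ₂ (standardMap κ₁ z)).2 - (standardMap κ₁ z).2) +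
        ((standardMap κ₁ z).2 - z.2)| := by simp
    _ ≤ _ := (abs_add_le _ _).trans (by linarith)

theorem T_shift (k : ℤ) : Function.Commute (T κ₁ κ₂) (shift k) := by
  rw [T_eq_standardMap_comp]
  exact (standardMap_shift _ k).comp_left (standardMap_shift _ k)

variable {κ₁ κ₂}

/-- The orbit of a point above an essential invariant circle never gets below the circle. -/
theorem le_iterate_of_above {C : Set Cylinder} (hC : IsEssentialInvariantCircle (T κ₁ κ₂) C)
    {m M : ℝ} (hm : ∀ p ∈ C, m ≤ p.2) (hM : ∀ p ∈ C, p.2 ≤ M) {z : Cylinder} (hz : M < z.2)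
    (n : ℕ) : m ≤ ((T κ₁ κ₂)^[n] z).2 := by
  obtain ⟨⟨γ, -, rfl, hγ⟩, hinv⟩ := hC
  by_contra! hlt
  have hmaps : MapsTo (T κ₁ κ₂) (range γ)ᶜ (range γ)ᶜ := by
    intro w hw hTw
    rw [← hinv] at hTw
    exact hw ((T_injective κ₁ κ₂).mem_set_image.1 hTw)
  set B := |κ₁ / (2 * Real.pi)| + |κ₂ / (2 * Real.pi)| with hB
  have hB0 : 0 ≤ B := by positivity
  obtain ⟨w, hw, hj⟩ := joinedIn_iterate (continuous_T κ₁ κ₂) hmaps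
    (isPathConnected_height (ordConnected_Ioi (a := M)) ⟨M + 1, by simp⟩)
    (fun w hw hwC => absurd (hM w hwC) (not_le.2 hw))
    -- One application of `T` changes heights by at most `B`, so this point and its image both lie
    -- above `M`.
    ⟨(0, M + B + 1), show M < M + B + 1 by linarith, by
      have := (abs_le.1 (abs_T_snd_sub_le κ₁ κ₂ (0, M + B + 1))).1
      change M < _
      simp only [← hB] at this
      linarith⟩ hz n
  exact not_joinedIn_compl_range hγ (fun p hp => hlt.trans_le (hm p hp))
    (fun p hp => (hM p hp).trans_lt hw) hj

/-- The orbit of a point below an essential invariant circle never gets above the circle. -/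
theorem iterate_le_of_below {C : Set Cylinder} (hC : IsEssentialInvariantCircle (T κ₁ κ₂) C)
    {m M : ℝ} (hm : ∀ p ∈ C, m ≤ p.2) (hM : ∀ p ∈ C, p.2 ≤ M) {z : Cylinder} (hz : z.2 < m)
    (n : ℕ) : ((T κ₁ κ₂)^[n] z).2 ≤ M := by
  obtain ⟨⟨γ, -, rfl, hγ⟩, hinv⟩ := hC
  by_contra! hlt
  have hmaps : MapsTo (T κ₁ κ₂) (range γ)ᶜ (range γ)ᶜ := by
    intro w hw hTw
    rw [← hinv] at hTw
    exact hw ((T_injective κ₁ κ₂).mem_set_image.1 hTw)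
  set B := |κ₁ / (2 * Real.pi)| + |κ₂ / (2 * Real.pi)| with hB
  have hB0 : 0 ≤ B := by positivity
  obtain ⟨w, hw, hj⟩ := joinedIn_iterate (continuous_T κ₁ κ₂) hmaps
    (isPathConnected_height (ordConnected_Iio (a := m)) ⟨m - 1, by simp⟩)
    (fun w hw hwC => absurd (hm w hwC) (not_le.2 hw))
    ⟨(0, m - B - 1), show m - B - 1 < m by linarith, by
      have := (abs_le.1 (abs_T_snd_sub_le κ₁ κ₂ (0, m - B - 1))).2
      change _ < m
      simp only [← hB] at this
      linarith⟩ hz n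
  exact not_joinedIn_compl_range hγ (fun p hp => (hw.trans_le (hm p hp)))
    (fun p hp => (hM p hp).trans_lt hlt) hj.symm

theorem iterate_snd_shift (k : ℤ) (z : Cylinder) (n : ℕ) :
    ((T κ₁ κ₂)^[n] (shift k z)).2 = ((T κ₁ κ₂)^[n] z).2 + k := by
  rw [((T_shift κ₁ κ₂ k).iterate_left n).eq]
  rfl

/-- An essential invariant circle of amplitude less than `1` confines all orbits. -/
theorem abs_iterate_snd_sub_le {C : Set Cylinder}
    (hC : IsEssentialInvariantCircle (T κ₁ κ₂) C) (hA : amplitude C < 1) (z : Cylinder) (n : ℕ) :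
    |((T κ₁ κ₂)^[n] z).2 - z.2| ≤ 2 := by
  have hcomp : IsCompact (Prod.snd '' C) := by
    obtain ⟨⟨γ, -, rfl, -⟩, -⟩ := hC
    exact (isCompact_range γ.continuous).image continuous_snd
  have hm : ∀ p ∈ C, sInf (Prod.snd '' C) ≤ p.2 := fun p hp =>
    csInf_le hcomp.bddBelow (mem_image_of_mem _ hp)
  have hM : ∀ p ∈ C, p.2 ≤ sSup (Prod.snd '' C) := fun p hp =>
    le_csSup hcomp.bddAbove (mem_image_of_mem _ hp)
  rw [amplitude] at hA
  generalize sInf (Prod.snd '' C) = m at *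
  generalize sSup (Prod.snd '' C) = M at *
  rw [abs_le]
  constructor
  -- The smallest integer shift that puts `z` above `M` places it at height at most `M + 1`; the
  -- orbit then drops by at most `M + 1 - m < 2`.
  · have h1 := le_iterate_of_above hC hm hM (z := shift (⌊M - z.2⌋ + 1) z) (by
      have := Int.lt_floor_add_one (M - z.2)
      simp only [shift]
      push_cast
      linarith) n
    rw [iterate_snd_shift] at h1
    have := Int.floor_le (M - z.2)
    push_cast at h1
    linarith
  · have h1 := iterate_le_of_below hC hm hM (z := shift (⌈m - z.2⌉ - 1) z) (by
      have := Int.ceil_lt_add_one (m - z.2)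
      simp only [shift]
      push_cast
      linarith) n
    rw [iterate_snd_shift] at h1
    have := Int.le_ceil (m - z.2)
    push_cast at h1
    linarith

end

/-! ### Semiconcave potentials and infimal convolution. -/

/-- The Moreau envelope of a function on the line. -/
noncomputable def envelope (W : ℝ → ℝ) (x' : ℝ) : ℝ := ⨅ x, (W x + (x' - x) ^ 2 / 2)

/-- The infimum defining `envelope W x'` is attained at `x`. -/
def IsMinimizer (W : ℝ → ℝ) (x' x : ℝ) : Prop :=
  ∀ y, W x + (x' - x) ^ 2 / 2 ≤ W y + (x' - y) ^ 2 / 2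

/-- Lower semicontinuous functions which grow by `c` over each period. -/
structure QuasiPeriodic (c : ℝ) (W : ℝ → ℝ) : Prop where
  lsc : LowerSemicontinuous W
  add_one : ∀ x, W (x + 1) = W x + c

/-- `p` is a supergradient of the semiconcave function `v` at `x`. -/
def IsSupergradient (v : ℝ → ℝ) (x p : ℝ) : Prop :=
  ∀ y, v y ≤ v x + p * (y - x) + (y - x) ^ 2 / 2

/-- Semiconcave functions which grow by `c` over each period. -/
structure IsPotential (c : ℝ) (v : ℝ → ℝ) : Prop where
  add_one : ∀ x, v (x + 1) = v x + c
  exists_supergradient : ∀ x, ∃ p, IsSupergradient v x p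

theorem add_int_of_add_one {v : ℝ → ℝ} {c : ℝ} (h : ∀ x, v (x + 1) = v x + c) (x : ℝ) (n : ℤ) :
    v (x + n) = v x + n * c := by
  induction n using Int.induction_on with
  | zero => simp
  | succ n ih =>
    push_cast at *
    rw [← add_assoc, h, ih]
    ring
  | pred n ih =>
    have := h (x + ((-(n : ℤ) - 1 : ℤ) : ℝ))
    push_cast at *
    rw [show x + (-(n : ℝ) - 1) + 1 = x + -n by ring, ih] at this
    linarith

/-- Test the supergradient inequality one period to the right and one to the left of `x`. -/
theorem IsSupergradient.abs_sub_le {v : ℝ → ℝ} {c x p : ℝ} (hp : IsSupergradient v x p)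
    (h : ∀ x, v (x + 1) = v x + c) : |p - c| ≤ 1 / 2 := by
  have h1 := hp (x + 1)
  have h2 := hp (x - 1)
  have h3 := h (x - 1)
  rw [sub_add_cancel] at h3
  rw [h] at h1
  rw [abs_le]
  constructor <;> nlinarith

namespace IsPotential

variable {c : ℝ} {v : ℝ → ℝ}

theorem add_int (hv : IsPotential c v) (x : ℝ) (n : ℤ) : v (x + n) = v x + n * c :=
  add_int_of_add_one hv.add_one x n

theorem abs_sub_sub_le (hv : IsPotential c v) (x y : ℝ) : |v x - v y - c * (x - y)| ≤ 1 := by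
  have hx := hv.add_int (x - ⌊x - y⌋) ⌊x - y⌋
  rw [sub_add_cancel] at hx
  obtain ⟨p, hp⟩ := hv.exists_supergradient y
  obtain ⟨q, hq⟩ := hv.exists_supergradient (x - ⌊x - y⌋)
  have hp' := abs_le.1 (hp.abs_sub_le hv.add_one)
  have hq' := abs_le.1 (hq.abs_sub_le hv.add_one)
  have h1 := hp (x - ⌊x - y⌋)
  have h2 := hq y
  have hf0 := Int.floor_le (x - y)
  have hf1 := Int.lt_floor_add_one (x - y)
  set n : ℝ := (⌊x - y⌋ : ℝ)
  have e : v x - v y - c * (x - y) = v (x - n) - v y - c * (x - n - y) := by rw [hx]; ring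
  set t := x - n - y with ht
  have ht0 : 0 ≤ t := by linarith
  have ht1 : t ≤ 1 := by linarith
  have ht2 : y - (x - n) = -t := by rw [ht]; ring
  rw [ht2] at h2
  rw [e, abs_le]
  constructor <;> nlinarith

/-- The Lipschitz constant depends on `c` only; this equicontinuity lets pointwise convergence
control minimizers. -/
theorem abs_sub_le (hv : IsPotential c v) {x y : ℝ} (hxy : |x - y| ≤ 1) :
    |v x - v y| ≤ (|c| + 1) * |x - y| := by
  have key : ∀ a b : ℝ, |a - b| ≤ 1 → v a - v b ≤ (|c| + 1) * |a - b| := by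
    intro a b hab
    obtain ⟨p, hp⟩ := hv.exists_supergradient b
    have h1 := hp a
    have hpc : |p| ≤ |c| + 1 / 2 := by
      calc |p| = |(p - c) + c| := by ring_nf
        _ ≤ _ := by linarith [abs_add_le (p - c) c, hp.abs_sub_le hv.add_one]
    have h2 : p * (a - b) ≤ (|c| + 1 / 2) * |a - b| :=
      (le_abs_self _).trans (by rw [abs_mul]; gcongr)
    have h3 : (a - b) ^ 2 / 2 ≤ 1 / 2 * |a - b| := by
      rw [← sq_abs]
      nlinarith [abs_nonneg (a - b)]
    linarith
  rw [abs_le]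
  have h1 := key x y hxy
  have h2 := key y x (by rwa [abs_sub_comm])
  rw [abs_sub_comm y x] at h2
  constructor <;> linarith

theorem continuous (hv : IsPotential c v) : Continuous v := by
  rw [Metric.continuous_iff]
  intro x ε hε
  have hc : 0 < |c| + 1 := by positivity
  refine ⟨min 1 (ε / (|c| + 1)), by positivity, fun y hy => ?_⟩
  rw [Real.dist_eq] at hy ⊢
  calc |v y - v x| ≤ (|c| + 1) * |y - x| := hv.abs_sub_le (hy.le.trans (min_le_left _ _))
    _ < (|c| + 1) * (ε / (|c| + 1)) := by gcongr; exact hy.trans_le (min_le_right _ _)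
    _ = ε := by field_simp

theorem quasiPeriodic_add (hv : IsPotential c v) {V : ℝ → ℝ} (hV : Continuous V)
    (hV1 : Function.Periodic V 1) : QuasiPeriodic c (v + V) where
  lsc := (hv.continuous.add hV).lowerSemicontinuous
  add_one x := by simp only [Pi.add_apply, hv.add_one, hV1 x]; ring

theorem add_const (hv : IsPotential c v) (b : ℝ) : IsPotential c (fun x => v x + b) where
  add_one x := by rw [hv.add_one]; ring
  exists_supergradient x := (hv.exists_supergradient x).imp fun p hp y => by linarith [hp y]

theorem inf {w : ℝ → ℝ} (hv : IsPotential c v) (hw : IsPotential c w) : IsPotential c (v ⊓ w) where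
  add_one x := by simp only [Pi.inf_apply, hv.add_one, hw.add_one, ← min_add_add_right]
  exists_supergradient x := by
    rcases le_total (v x) (w x) with h | h
    · obtain ⟨p, hp⟩ := hv.exists_supergradient x
      exact ⟨p, fun y => by
        simp only [Pi.inf_apply, min_eq_left h]; exact (min_le_left _ _).trans (hp y)⟩
    · obtain ⟨p, hp⟩ := hw.exists_supergradient x
      exact ⟨p, fun y => by
        simp only [Pi.inf_apply, min_eq_right h]; exact (min_le_right _ _).trans (hp y)⟩

theorem eq_sub (hv : IsPotential c v) : c = v 1 - v 0 := by
  have := hv.add_one 0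
  rw [zero_add] at this
  linarith

end IsPotential

theorem IsMinimizer.envelope_eq {W : ℝ → ℝ} {x' x : ℝ} (h : IsMinimizer W x' x) :
    envelope W x' = W x + (x' - x) ^ 2 / 2 :=
  le_antisymm (ciInf_le ⟨_, by rintro _ ⟨y, rfl⟩; exact h y⟩ x) (le_ciInf h)

namespace QuasiPeriodic

variable {c : ℝ} {W : ℝ → ℝ}

theorem exists_linear_le (hW : QuasiPeriodic c W) : ∃ m, ∀ x, m + c * x ≤ W x := by
  obtain ⟨x₀, -, hx₀⟩ := (hW.lsc.lowerSemicontinuousOn (Icc 0 1)).exists_isMinOn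
    (nonempty_Icc.2 zero_le_one) isCompact_Icc
  refine ⟨W x₀ - |c|, fun x => ?_⟩
  have h1 : W x₀ ≤ W (Int.fract x) := hx₀ ⟨Int.fract_nonneg x, (Int.fract_lt_one x).le⟩
  have h2 := add_int_of_add_one hW.add_one (Int.fract x) ⌊x⌋
  rw [Int.fract_add_floor] at h2
  have h3 : c * Int.fract x ≤ |c| := by
    refine (le_abs_self _).trans ?_
    rw [abs_mul, abs_of_nonneg (Int.fract_nonneg x)]
    exact mul_le_of_le_one_right (abs_nonneg c) (Int.fract_lt_one x).le
  have h4 : c * x = c * Int.fract x + ⌊x⌋ * c := by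
    conv_lhs => rw [← Int.fract_add_floor x]
    ring
  linarith

theorem exists_isMinimizer (hW : QuasiPeriodic c W) (x' : ℝ) : ∃ x, IsMinimizer W x' x := by
  obtain ⟨m, hm⟩ := hW.exists_linear_le
  -- Beyond distance `R` from `x'`, the quadratic term added to the linear lower bound already
  -- exceeds `W x'`, the value of the functional at `x'`.
  set R := 2 * |c| + 2 + |m + c * x' - W x'| with hR
  have hR0 : 0 ≤ R := by positivity
  have hls : LowerSemicontinuous fun x => W x + (x' - x) ^ 2 / 2 :=
    hW.lsc.add (Continuous.lowerSemicontinuous (by fun_prop))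
  obtain ⟨x, -, hx⟩ := (hls.lowerSemicontinuousOn (Icc (x' - R) (x' + R))).exists_isMinOn
    (nonempty_Icc.2 (by linarith)) isCompact_Icc
  refine ⟨x, fun y => ?_⟩
  by_cases hy : |y - x'| ≤ R
  · exact hx (by rw [abs_le] at hy; constructor <;> linarith)
  · push Not at hy
    have h1 : W x + (x' - x) ^ 2 / 2 ≤ W x' + (x' - x') ^ 2 / 2 :=
      hx ⟨by linarith, by linarith⟩
    have h2 := hm y
    have h3 : -(|c| * |y - x'|) ≤ c * (y - x') := by
      rw [← abs_mul]
      exact neg_abs_le _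
    have h4 : (x' - y) ^ 2 = |y - x'| ^ 2 := by rw [sq_abs]; ring
    have h5 := neg_abs_le (m + c * x' - W x')
    have h6 : 0 ≤ |m + c * x' - W x'| := abs_nonneg _
    rw [h4]
    have h7 : |y - x'| * 1 ≤ |y - x'| * (|y - x'| / 2 - |c|) := by
      gcongr
      linarith
    have h8 : c * y = c * x' + c * (y - x') := by ring
    have h9 : (x' - x') ^ 2 = 0 := by ring
    have h10 := abs_nonneg c
    rw [h9] at h1
    nlinarith

/-- An infimum of parabolas in `x'` with leading coefficient 1/2 is semiconcave, whatever the
regularity of `W`: the parabola of a minimizer `x` touches from above at `x'`, with slope `x' - x`.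
-/
theorem isPotential_envelope (hW : QuasiPeriodic c W) : IsPotential c (envelope W) where
  add_one x' := by
    rw [envelope, envelope, ← (Equiv.addRight (1 : ℝ)).iInf_comp]
    obtain ⟨x, hx⟩ := hW.exists_isMinimizer x'
    rw [ciInf_add ⟨_, by rintro _ ⟨y, rfl⟩; exact hx y⟩]
    congr with x
    simp only [Equiv.coe_addRight, hW.add_one]
    ring
  exists_supergradient x' := by
    obtain ⟨x, hx⟩ := hW.exists_isMinimizer x'
    refine ⟨x' - x, fun y' => ?_⟩
    obtain ⟨y, hy⟩ := hW.exists_isMinimizer y'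
    rw [hx.envelope_eq, hy.envelope_eq]
    nlinarith [hy x]

end QuasiPeriodic

theorem IsMinimizer.isSupergradient {c : ℝ} {W : ℝ → ℝ} (hW : QuasiPeriodic c W) {x' x : ℝ}
    (h : IsMinimizer W x' x) : IsSupergradient (envelope W) x' (x' - x) := by
  intro y'
  obtain ⟨y, hy⟩ := hW.exists_isMinimizer y'
  rw [h.envelope_eq, hy.envelope_eq]
  nlinarith [hy x]

theorem IsMinimizer.abs_sub_le {c : ℝ} {W : ℝ → ℝ} (hW : QuasiPeriodic c W) {x' x : ℝ}
    (h : IsMinimizer W x' x) : |x' - x - c| ≤ 1 / 2 :=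
  (h.isSupergradient hW).abs_sub_le hW.isPotential_envelope.add_one

theorem IsMinimizer.add_int {c : ℝ} {W : ℝ → ℝ} (hW : ∀ x, W (x + 1) = W x + c) {x' x : ℝ}
    (h : IsMinimizer W x' x) (n : ℤ) : IsMinimizer W (x' + n) (x + n) := by
  intro y
  have h1 := h (y - n)
  have h2 := add_int_of_add_one hW x n
  have h3 := add_int_of_add_one hW (y - n) n
  rw [sub_add_cancel] at h3
  have e1 : x' + n - (x + n) = x' - x := by ring
  have e2 : x' - (y - n) = x' + n - y := by ring
  rw [h2, e1, h3]
  rw [e2] at h1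
  linarith

theorem IsSupergradient.hasDerivAt_eq {v : ℝ → ℝ} {x p q : ℝ} (hp : IsSupergradient v x p)
    (hq : HasDerivAt v q x) : q = p := by
  have hmin : IsLocalMin (fun y => v x + p * (y - x) + (y - x) ^ 2 / 2 - v y) x :=
    Eventually.of_forall fun y => by
      have := hp y
      simp only [sub_self]
      linarith
  have hd : HasDerivAt (fun y => v x + p * (y - x) + (y - x) ^ 2 / 2 - v y) (p - q) x := by
    have h1 : HasDerivAt (fun y => y - x) 1 x := (hasDerivAt_id x).sub_const x
    have h2 := (((h1.const_mul p).const_add (v x)).add ((h1.pow 2).div_const 2)).sub hq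
    refine h2.congr_deriv ?_
    simp
  linarith [hmin.hasDerivAt_eq_zero hd]

/-- A semiconcave function touched from below by a differentiable one is differentiable. -/
theorem IsSupergradient.hasDerivAt_of_le {m w : ℝ → ℝ} {x p q : ℝ} (hp : IsSupergradient w x p)
    (hm : HasDerivAt m q x) (hle : ∀ y, m y ≤ w y) (heq : m x = w x) : HasDerivAt w q x := by
  have hpm : IsSupergradient m x p := fun y => by rw [heq]; exact (hle y).trans (hp y)
  obtain rfl := hpm.hasDerivAt_eq hm
  have h1 : HasDerivAt (fun y => y - x) 1 x := (hasDerivAt_id x).sub_const x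
  have hU : HasDerivAt (fun y => w x + q * (y - x) + (y - x) ^ 2 / 2) q x := by
    have h2 := ((h1.const_mul q).const_add (w x)).add ((h1.pow 2).div_const 2)
    refine h2.congr_deriv ?_
    simp
  rw [hasDerivAt_iff_isLittleO] at *
  have hsum := hm.norm_left.add hU.norm_left
  refine (Asymptotics.IsBigO.of_bound 1 (Eventually.of_forall fun y => ?_)).trans_isLittleO hsum
  simp only [Real.norm_eq_abs, smul_eq_mul, one_mul, sub_self, heq]
  refine le_trans ?_ (le_abs_self _)
  rw [abs_le]
  have h2 := hle y
  have h3 := hp y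
  have a1 := neg_abs_le (m y - w x - (y - x) * q)
  have a2 := le_abs_self (w x + q * (y - x) + (y - x) ^ 2 / 2 - (w x + q * 0 + 0 ^ 2 / 2)
    - (y - x) * q)
  have a3 := abs_nonneg (m y - w x - (y - x) * q)
  have a4 := abs_nonneg (w x + q * (y - x) + (y - x) ^ 2 / 2 - (w x + q * 0 + 0 ^ 2 / 2)
    - (y - x) * q)
  constructor <;> linarith

/-- At a minimizer of `w + g`, the potential `w` is differentiable. -/
theorem IsMinimizer.hasDerivAt {c : ℝ} {w g : ℝ → ℝ} (hw : IsPotential c w) {x' x g' : ℝ}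
    (h : IsMinimizer (w + g) x' x) (hg : HasDerivAt g g' x) : HasDerivAt w (x' - x - g') x := by
  obtain ⟨p, hp⟩ := hw.exists_supergradient x
  have h1 : HasDerivAt (fun y => x' - y) (-1) x := (hasDerivAt_id x).const_sub x'
  refine hp.hasDerivAt_of_le
    (m := fun y => w x + g x + (x' - x) ^ 2 / 2 - (g y + (x' - y) ^ 2 / 2)) ?_ (fun y => ?_) ?_
  · have h2 := (hg.add ((h1.pow 2).div_const 2)).const_sub (w x + g x + (x' - x) ^ 2 / 2)
    refine h2.congr_deriv ?_
    simp
    ring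
  · have := h y
    simp only [Pi.add_apply] at this
    linarith
  · ring

theorem IsMinimizer.eq_of_hasDerivAt {c : ℝ} {W : ℝ → ℝ} (hW : QuasiPeriodic c W) {x' x p : ℝ}
    (h : IsMinimizer W x' x) (hp : HasDerivAt (envelope W) p x') : p = x' - x :=
  (h.isSupergradient hW).hasDerivAt_eq hp

/-- The differential of a potential, as a subset of the cylinder. -/
def graph (v : ℝ → ℝ) : Set Cylinder := {z | ∃ x p, HasDerivAt v p x ∧ z = ((x : UnitAddCircle), p)}

/-! ### Compactness of potentials for pointwise convergence. -/

theorem isSupergradient_of_tendsto {ι : Type*} {l : Filter ι} [l.NeBot] {w : ι → ℝ → ℝ}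
    {v : ℝ → ℝ} {ξ π : ι → ℝ} {x p : ℝ} (hw : ∀ y, Tendsto (fun i => w i y) l (𝓝 (v y)))
    (hwx : Tendsto (fun i => w i (ξ i)) l (𝓝 (v x))) (hξ : Tendsto ξ l (𝓝 x))
    (hπ : Tendsto π l (𝓝 p)) (h : ∀ᶠ i in l, IsSupergradient (w i) (ξ i) (π i)) :
    IsSupergradient v x p := fun y =>
  le_of_tendsto_of_tendsto (hw y)
    ((hwx.add (hπ.mul (hξ.const_sub y))).add (((hξ.const_sub y).pow 2).div_const 2))
    (h.mono fun _ hi => hi y)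

/-- The potentials whose mean slope is bounded by `C`. -/
def potentials (C : ℝ) : Set (ℝ → ℝ) := {v | IsPotential (v 1 - v 0) v ∧ |v 1 - v 0| ≤ C}

theorem IsPotential.mem_potentials {c C : ℝ} {v : ℝ → ℝ} (hv : IsPotential c v) (hc : |c| ≤ C) :
    v ∈ potentials C := by
  obtain rfl := hv.eq_sub
  exact ⟨hv, hc⟩

theorem isClosed_potentials (C : ℝ) : IsClosed (potentials C) := by
  rw [isClosed_iff_ultrafilter]
  intro v u hu hmem
  have hev : ∀ x, Tendsto (fun w : ℝ → ℝ => w x) u (𝓝 (v x)) := fun x =>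
    ((continuous_apply x).tendsto v).mono_left hu
  refine ⟨⟨fun x => ?_, fun x => ?_⟩, ?_⟩
  · refine tendsto_nhds_unique_of_eventuallyEq (hev (x + 1))
      ((hev x).add ((hev 1).sub (hev 0))) ?_
    filter_upwards [hmem] with w hw using hw.1.add_one x
  -- Supergradients at `x` lie in a fixed compact interval, so a selection of them converges along
  -- the ultrafilter. The value 0 off `potentials C` only makes the selection total.
  · have hex : ∀ w : ℝ → ℝ, ∃ p ∈ Icc (-(C + 1 / 2)) (C + 1 / 2),
        w ∈ potentials C → IsSupergradient w x p := by
      intro w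
      by_cases hw : w ∈ potentials C
      · obtain ⟨p, hp⟩ := hw.1.exists_supergradient x
        have h1 := abs_le.1 (hp.abs_sub_le hw.1.add_one)
        have h2 := abs_le.1 hw.2
        exact ⟨p, ⟨by linarith, by linarith⟩, fun _ => hp⟩
      · have hC : 0 ≤ C := by
          obtain ⟨w', hw'⟩ := u.nonempty_of_mem hmem
          exact (abs_nonneg _).trans hw'.2
        exact ⟨0, ⟨by linarith, by linarith⟩, fun h => absurd h hw⟩
    choose P hP hPs using hex
    obtain ⟨p, -, hp⟩ := isCompact_Icc.ultrafilter_le_nhds (u.map P)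
      (le_principal_iff.2 (Ultrafilter.mem_map.2 (univ_mem' hP)))
    exact ⟨p, isSupergradient_of_tendsto (l := u) (w := fun w => w) hev (hev x) tendsto_const_nhds (show Tendsto P u (𝓝 p) from hp)
      (by filter_upwards [hmem] with w hw using hPs w hw)⟩
  · refine le_of_tendsto ((hev 1).sub (hev 0)).abs ?_
    filter_upwards [hmem] with w hw using hw.2

theorem isClosed_isPotential (c : ℝ) : IsClosed {v | IsPotential c v} := by
  have : {v | IsPotential c v} = potentials |c| ∩ {v | v 1 - v 0 = c} := by
    ext v
    refine ⟨fun hv => ⟨hv.mem_potentials le_rfl, hv.eq_sub.symm⟩, ?_⟩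
    rintro ⟨⟨hv, -⟩, h⟩
    rwa [h] at hv
  rw [this]
  exact (isClosed_potentials _).inter (isClosed_eq (by fun_prop) (by fun_prop))

theorem isCompact_potentials (C : ℝ) : IsCompact {v ∈ potentials C | v 0 = 0} := by
  refine (isCompact_univ_pi fun x : ℝ =>
    isCompact_Icc (a := -(C * |x| + 1)) (b := C * |x| + 1)).of_isClosed_subset
    ((isClosed_potentials C).inter (isClosed_eq (by fun_prop) (by fun_prop))) ?_
  rintro v ⟨hv, h0⟩ x -
  have h1 := hv.1.abs_sub_sub_le x 0
  rw [h0, sub_zero, sub_zero, sub_zero] at h1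
  have h2 : |v 1 * x| ≤ C * |x| := by
    rw [abs_mul]
    have := hv.2
    rw [h0, sub_zero] at this
    gcongr
  rw [abs_le] at h1 h2
  constructor <;> linarith

/-- On potentials, pointwise closeness is uniform on bounded sets. -/
theorem eventually_abs_sub_le {C : ℝ} {v : ℝ → ℝ} (hv : v ∈ potentials C) (R : ℝ) {δ : ℝ}
    (hδ : 0 < δ) : ∀ᶠ w in 𝓝[potentials C] v, ∀ x ∈ Icc (-R) R, |w x - v x| ≤ δ := by
  have hC : 0 ≤ C := (abs_nonneg _).trans hv.2
  -- Potentials of slope at most `C` are `(C + 1)`-Lipschitz at scale 1, so each oscillates by at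
  -- most `δ / 3` over a ball of radius `r`.
  set r := min 1 (δ / (3 * (C + 1))) with hr
  have hr0 : 0 < r := by positivity
  obtain ⟨t, -, htf, htc⟩ := (isCompact_Icc (a := -R) (b := R)).finite_cover_balls hr0
  have hev : ∀ᶠ w in 𝓝[potentials C] v, ∀ a ∈ t, |w a - v a| < δ / 3 := by
    rw [eventually_all_finite htf]
    intro a _
    have : Tendsto (fun w : ℝ → ℝ => |w a - v a|) (𝓝[potentials C] v) (𝓝 |v a - v a|) :=
      (((continuous_apply a).sub continuous_const).abs.tendsto v).mono_left nhdsWithin_le_nhds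
    refine this.eventually_lt_const ?_
    rw [sub_self, abs_zero]
    positivity
  filter_upwards [hev, self_mem_nhdsWithin] with w hw hwC x hx
  obtain ⟨a, ha, hxa⟩ := mem_iUnion₂.1 (htc hx)
  rw [Metric.mem_ball, Real.dist_eq] at hxa
  have hosc : ∀ u ∈ potentials C, |u x - u a| ≤ δ / 3 := by
    intro u hu
    calc |u x - u a| ≤ (|u 1 - u 0| + 1) * |x - a| :=
          hu.1.abs_sub_le (hxa.le.trans (min_le_left _ _))
      _ ≤ (C + 1) * (δ / (3 * (C + 1))) := by
          gcongr
          · exact hu.2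
          · exact hxa.le.trans (min_le_right _ _)
      _ = δ / 3 := by field_simp
  have h1 := abs_le.1 (hosc w hwC)
  have h2 := abs_le.1 (hosc v hv)
  have h3 := abs_lt.1 (hw a ha)
  rw [abs_le]
  constructor <;> linarith

theorem QuasiPeriodic.envelope_le {c : ℝ} {W : ℝ → ℝ} (hW : QuasiPeriodic c W) (x' x : ℝ) :
    envelope W x' ≤ W x + (x' - x) ^ 2 / 2 := by
  obtain ⟨y, hy⟩ := hW.exists_isMinimizer x'
  rw [hy.envelope_eq]
  exact hy x

/-! ### Lax–Oleinik operators. -/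

/-- The properties of a Lax–Oleinik operator used in the construction of its fixed points. -/
structure IsLaxOleinik (Λ : (ℝ → ℝ) → ℝ → ℝ) : Prop where
  isPotential : ∀ {c v}, IsPotential c v → IsPotential c (Λ v)
  map_add_const : ∀ {c v}, IsPotential c v → ∀ b, Λ (fun x => v x + b) = fun x => Λ v x + b
  map_inf : ∀ {c v w}, IsPotential c v → IsPotential c w → Λ (v ⊓ w) = Λ v ⊓ Λ w
  continuousOn : ∀ C, ContinuousOn Λ (potentials C)

namespace IsLaxOleinik

variable {Λ Λ' : (ℝ → ℝ) → ℝ → ℝ} {c : ℝ} {v w : ℝ → ℝ}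

theorem mono (hΛ : IsLaxOleinik Λ) (hv : IsPotential c v) (hw : IsPotential c w) (h : v ≤ w) :
    Λ v ≤ Λ w := by
  have := hΛ.map_inf hv hw
  rw [inf_eq_left.2 h] at this
  rw [this]
  exact inf_le_right

theorem mapsTo (hΛ : IsLaxOleinik Λ) (C : ℝ) : MapsTo Λ (potentials C) (potentials C) :=
  fun _ hv => (hΛ.isPotential hv.1).mem_potentials hv.2

theorem comp (hΛ : IsLaxOleinik Λ) (hΛ' : IsLaxOleinik Λ') : IsLaxOleinik (Λ ∘ Λ') where
  isPotential hv := hΛ.isPotential (hΛ'.isPotential hv)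
  map_add_const hv b := by
    simp only [Function.comp_apply, hΛ'.map_add_const hv,
      hΛ.map_add_const (hΛ'.isPotential hv)]
  map_inf hv hw := by
    simp only [Function.comp_apply, hΛ'.map_inf hv hw,
      hΛ.map_inf (hΛ'.isPotential hv) (hΛ'.isPotential hw)]
  continuousOn C := (hΛ.continuousOn C).comp (hΛ'.continuousOn C) (hΛ'.mapsTo C)

theorem id : IsLaxOleinik id where
  isPotential hv := hv
  map_add_const _ _ := rfl
  map_inf _ _ := rfl
  continuousOn _ := continuousOn_id

theorem iterate (hΛ : IsLaxOleinik Λ) (n : ℕ) : IsLaxOleinik Λ^[n] := by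
  induction n with
  | zero => exact .id
  | succ n ih => exact ih.comp hΛ

theorem add_const (hΛ : IsLaxOleinik Λ) (b : ℝ) : IsLaxOleinik (fun v x => Λ v x + b) where
  isPotential hv := (hΛ.isPotential hv).add_const b
  map_add_const hv a := by
    simp only [hΛ.map_add_const hv]
    ext
    ring
  map_inf hv hw := by
    rw [hΛ.map_inf hv hw]
    ext x
    simp [min_add_add_right]
  continuousOn C := continuousOn_pi.2 fun x =>
    (continuousOn_pi.1 (hΛ.continuousOn C) x).add continuousOn_const

end IsLaxOleinik

/-- One step of the Lax–Oleinik semigroup of the standard map with potential `V`. -/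
noncomputable def step (V v : ℝ → ℝ) : ℝ → ℝ := envelope (v + V)

theorem isLaxOleinik_step {V : ℝ → ℝ} (hV : Continuous V) (hV1 : Function.Periodic V 1) :
    IsLaxOleinik (step V) where
  isPotential hv := (hv.quasiPeriodic_add hV hV1).isPotential_envelope
  map_add_const {c v} hv b := by
    ext x'
    obtain ⟨x, hx⟩ := (hv.quasiPeriodic_add hV hV1).exists_isMinimizer x'
    have hx' : IsMinimizer ((fun x => v x + b) + V) x' x := fun y => by
      have := hx y
      simp only [Pi.add_apply] at *
      linarith
    rw [step, step, hx.envelope_eq, hx'.envelope_eq]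
    simp only [Pi.add_apply]
    ring
  map_inf {c v w} hv hw := by
    have hv' := hv.quasiPeriodic_add hV hV1
    have hw' := hw.quasiPeriodic_add hV hV1
    have hi' := (hv.inf hw).quasiPeriodic_add hV hV1
    ext x'
    obtain ⟨x, hx⟩ := hv'.exists_isMinimizer x'
    obtain ⟨y, hy⟩ := hw'.exists_isMinimizer x'
    obtain ⟨z, hz⟩ := hi'.exists_isMinimizer x'
    refine le_antisymm (le_inf ?_ ?_) ?_
    · refine (hi'.envelope_le x' x).trans ?_
      rw [step, hx.envelope_eq]
      simp
    · refine (hi'.envelope_le x' y).trans ?_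
      rw [step, hy.envelope_eq]
      simp
    · simp only [Pi.inf_apply, step]
      rw [hz.envelope_eq]
      rcases le_total (v z) (w z) with h | h
      · refine (min_le_left _ _).trans ((hv'.envelope_le x' z).trans ?_)
        simp [h]
      · refine (min_le_right _ _).trans ((hw'.envelope_le x' z).trans ?_)
        simp [h]
  continuousOn C := by
    refine continuousOn_pi.2 fun x' v hv => ?_
    rw [ContinuousWithinAt, Metric.tendsto_nhds]
    intro ε hε
    -- Minimizers for `x'` stay in one bounded interval, where closeness of potentials is uniform.
    have hmin : ∀ u ∈ potentials C, ∃ x ∈ Icc (-(|x'| + C + 1)) (|x'| + C + 1),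
        IsMinimizer (u + V) x' x := by
      intro u hu
      have hq := hu.1.quasiPeriodic_add hV hV1
      obtain ⟨x, hx⟩ := hq.exists_isMinimizer x'
      have h1 := abs_le.1 (hx.abs_sub_le hq)
      have h2 := abs_le.1 hu.2
      have h3 := neg_abs_le x'
      have h4 := le_abs_self x'
      exact ⟨x, ⟨by linarith, by linarith⟩, hx⟩
    filter_upwards [eventually_abs_sub_le hv (|x'| + C + 1) (half_pos hε), self_mem_nhdsWithin]
      with w hw hwC
    obtain ⟨x, hxI, hx⟩ := hmin v hv
    obtain ⟨y, hyI, hy⟩ := hmin w hwC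
    have h1 := (hv.1.quasiPeriodic_add hV hV1).envelope_le x' y
    have h2 := (hwC.1.quasiPeriodic_add hV hV1).envelope_le x' x
    have h3 := hx.envelope_eq
    have h4 := hy.envelope_eq
    have h5 := abs_le.1 (hw x hxI)
    have h6 := abs_le.1 (hw y hyI)
    simp only [Pi.add_apply] at h1 h2 h3 h4
    rw [Real.dist_eq, step, step, abs_lt]
    constructor <;> linarith

/-! ### Weak KAM fixed points. -/

/-- A sequence which is additive up to a bounded error is linear up to a bounded error. -/
theorem exists_abs_sub_mul_le {b : ℕ → ℝ} {K : ℝ} (hb : ∀ n m, |b (n + m) - b n - b m| ≤ K) :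
    ∃ ℓ, ∀ n, |b n - n * ℓ| ≤ K := by
  have hK : 0 ≤ K := (abs_nonneg _).trans (hb 0 0)
  have hmul : ∀ n m : ℕ, |b ((m + 1) * n) - (m + 1) * b n| ≤ m * K := by
    intro n m
    induction m with
    | zero => simp
    | succ m ih =>
      have h1 := abs_le.1 (hb ((m + 1) * n) n)
      have h2 := abs_le.1 ih
      rw [show (m + 1 + 1) * n = (m + 1) * n + n by ring]
      push_cast
      rw [abs_le]
      constructor <;> linarith
  -- Compare `b ((n + 1) * (m + 1))` with both `(m + 1) * b (n + 1)` and `(n + 1) * b (m + 1)`. Any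
  -- number between the two families of quotients serves as `ℓ`.
  have hle : ∀ n m : ℕ, (b (n + 1) - K) / (n + 1) ≤ (b (m + 1) + K) / (m + 1) := by
    intro n m
    have h1 := abs_le.1 (hmul (n + 1) m)
    have h2 := abs_le.1 (hmul (m + 1) n)
    rw [mul_comm (n + 1) (m + 1)] at h2
    rw [div_le_div_iff₀ (by positivity) (by positivity)]
    nlinarith
  refine ⟨⨆ n : ℕ, (b (n + 1) - K) / (n + 1), fun n => ?_⟩
  rcases n with _ | n
  · have := hb 0 0
    simp only [add_zero, sub_self, zero_sub, abs_neg] at this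
    simpa using this
  · have hbdd : BddAbove (range fun n : ℕ => (b (n + 1) - K) / (n + 1)) :=
      ⟨_, by rintro _ ⟨m, rfl⟩; exact hle m 0⟩
    have h1 := le_ciSup hbdd n
    have h2 : (⨆ n : ℕ, (b (n + 1) - K) / (n + 1)) ≤ (b (n + 1) + K) / (n + 1) :=
      ciSup_le fun m => hle m n
    have hn : (0 : ℝ) < n + 1 := by positivity
    rw [div_le_iff₀ hn] at h1
    rw [le_div_iff₀ hn] at h2
    push_cast
    rw [abs_le]
    constructor <;> linarith

namespace IsLaxOleinik

variable {Λ : (ℝ → ℝ) → ℝ → ℝ} {c : ℝ} {S : Set (ℝ → ℝ)} {w : ℝ → ℝ}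

theorem tendsto (hΛ : IsLaxOleinik Λ) {ι : Type*} {l : Filter ι} {C : ℝ} {u : ι → ℝ → ℝ}
    {v : ℝ → ℝ} (hu : ∀ i, u i ∈ potentials C) (hv : v ∈ potentials C) (h : Tendsto u l (𝓝 v)) :
    Tendsto (fun i => Λ (u i)) l (𝓝 (Λ v)) :=
  (hΛ.continuousOn C v hv).tendsto.comp
    (tendsto_nhdsWithin_iff.2 ⟨h, Eventually.of_forall hu⟩)

/-- A Lax–Oleinik operator with a bounded orbit has a fixed point in the closure of each set which
contains the orbit and is stable under the operator and under minima. -/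
theorem exists_fixedPoint_of_bounded (hΛ : IsLaxOleinik Λ) (hS : ∀ v ∈ S, IsPotential c v)
    (hSΛ : MapsTo Λ S S) (hSinf : ∀ v ∈ S, ∀ w ∈ S, v ⊓ w ∈ S) (hw : w ∈ S) {K : ℝ}
    (hK : ∀ n x, |(Λ^[n] w) x - w x| ≤ K) : ∃ v ∈ closure S, Λ v = v := by
  have hcl : ∀ v ∈ closure S, IsPotential c v :=
    closure_minimal hS (isClosed_isPotential c)
  have hpot : ∀ v ∈ closure S, v ∈ potentials |c| := fun v hv => (hcl v hv).mem_potentials le_rfl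
  have hclΛ : MapsTo Λ (closure S) (closure S) := fun v hv =>
    ((hΛ.continuousOn |c| v (hpot v hv)).mono fun u hu => hpot u (subset_closure hu)).mem_closure
      hv hSΛ
  -- `m M` is the minimum of `w, Λ w, ..., Λ^[M] w`. Its decreasing limit `I` satisfies `I = w ⊓ Λ I
  -- ≤ Λ I`, so the iterates of `I` increase to a fixed point.
  obtain ⟨m, hm0, hm1⟩ : ∃ m : ℕ → ℝ → ℝ, m 0 = w ∧ ∀ M, m (M + 1) = w ⊓ Λ (m M) :=
    ⟨fun M => Nat.rec w (fun _ u => w ⊓ Λ u) M, rfl, fun _ => rfl⟩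
  have hmS : ∀ M, m M ∈ S := by
    intro M
    induction M with
    | zero => rwa [hm0]
    | succ M ih => rw [hm1]; exact hSinf _ hw _ (hSΛ ih)
  have hanti : Antitone m := by
    refine antitone_nat_of_succ_le fun M => ?_
    induction M with
    | zero => rw [hm1, hm0]; exact inf_le_left
    | succ M ih =>
      calc m (M + 1 + 1) = w ⊓ Λ (m (M + 1)) := hm1 _
        _ ≤ w ⊓ Λ (m M) := inf_le_inf_left _ (hΛ.mono (hS _ (hmS _)) (hS _ (hmS _)) ih)
        _ = m (M + 1) := (hm1 M).symm
  have hlow : ∀ M j x, w x - K ≤ (Λ^[j] (m M)) x := by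
    intro M
    induction M with
    | zero => exact fun j x => by rw [hm0]; linarith [(abs_le.1 (hK j x)).1]
    | succ M ih =>
      intro j x
      rw [hm1, (hΛ.iterate j).map_inf (hS _ hw) (hS _ (hSΛ (hmS M)))]
      exact le_min (by linarith [(abs_le.1 (hK j x)).1]) (ih (j + 1) x)
  have hmtend : Tendsto m atTop (𝓝 fun x => ⨅ M, m M x) := by
    refine tendsto_pi_nhds.2 fun x => tendsto_atTop_ciInf (fun _ _ h => hanti h x)
      ⟨w x - K, ?_⟩
    rintro _ ⟨M, rfl⟩
    exact hlow M 0 x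
  set I : ℝ → ℝ := fun x => ⨅ M, m M x
  have hI : I ∈ closure S := mem_closure_of_tendsto hmtend (Eventually.of_forall hmS)
  have hIeq : I = w ⊓ Λ I := by
    refine tendsto_nhds_unique ((tendsto_add_atTop_iff_nat 1).2 hmtend) ?_
    have h := hΛ.tendsto (fun M => hpot _ (subset_closure (hmS M))) (hpot I hI) hmtend
    simp only [hm1]
    exact tendsto_pi_nhds.2 fun x => tendsto_const_nhds.inf_nhds (tendsto_pi_nhds.1 h x)
  have hJ : ∀ N, Λ^[N] I ∈ closure S := fun N => hclΛ.iterate N hI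
  have hmono : Monotone fun N => Λ^[N] I := by
    refine monotone_nat_of_le_succ fun N => ?_
    refine (hΛ.iterate N).mono (hcl I hI) (hcl _ (hclΛ hI)) ?_
    conv_lhs => rw [hIeq]
    exact inf_le_right
  have hJtend : Tendsto (fun N => Λ^[N] I) atTop (𝓝 fun x => ⨆ N, (Λ^[N] I) x) := by
    refine tendsto_pi_nhds.2 fun x => tendsto_atTop_ciSup (fun _ _ h => hmono h x)
      ⟨w x + K, ?_⟩
    rintro _ ⟨N, rfl⟩
    have h1 : (Λ^[N] I) x ≤ (Λ^[N] w) x :=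
      (hΛ.iterate N).mono (hcl I hI) (hS w hw) (by rw [hIeq]; exact inf_le_left) x
    linarith [(abs_le.1 (hK N x)).2]
  have hv := closure_closure.subset
    (mem_closure_of_tendsto hJtend (Eventually.of_forall hJ))
  refine ⟨_, hv, ?_⟩
  refine tendsto_nhds_unique (hΛ.tendsto (fun N => hpot _ (hJ N)) (hpot _ hv) hJtend) ?_
  refine ((tendsto_add_atTop_iff_nat 1).2 hJtend).congr fun N => ?_
  rw [Function.iterate_succ_apply']

/-- The weak KAM theorem for the stable sets of a Lax–Oleinik operator. -/
theorem exists_weakKAM (hΛ : IsLaxOleinik Λ) (hS : ∀ v ∈ S, IsPotential c v)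
    (hSΛ : MapsTo Λ S S) (hSinf : ∀ v ∈ S, ∀ w ∈ S, v ⊓ w ∈ S)
    (hSadd : ∀ v ∈ S, ∀ b : ℝ, (fun x => v x + b) ∈ S) (hne : S.Nonempty) :
    ∃ v ∈ closure S, ∃ ℓ, Λ v = fun x => v x + ℓ := by
  obtain ⟨w, hw⟩ := hne
  have hpw : ∀ n, IsPotential c (Λ^[n] w) := fun n => (hΛ.iterate n).isPotential (hS w hw)
  set b : ℕ → ℝ := fun n => (Λ^[n] w) 0 - w 0 with hb
  -- Both potentials have the same slope `c`, and each deviates from its linear part by at most 1.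
  have hosc : ∀ n x, |(Λ^[n] w) x - w x - b n| ≤ 2 := by
    intro n x
    have h1 := abs_le.1 ((hpw n).abs_sub_sub_le x 0)
    have h2 := abs_le.1 ((hS w hw).abs_sub_sub_le x 0)
    simp only [hb, abs_le]
    constructor <;> linarith
  have hadd : ∀ n m, |b (n + m) - b n - b m| ≤ 2 := by
    intro n m
    have hle : (Λ^[n + m] w) 0 ≤ (Λ^[n] w) 0 + (b m + 2) := by
      rw [Function.iterate_add_apply]
      refine ((hΛ.iterate n).mono (hpw m) ((hS w hw).add_const (b m + 2)) (fun x => ?_) 0).trans_eq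
        (congrFun ((hΛ.iterate n).map_add_const (hS w hw) _) 0)
      linarith [(abs_le.1 (hosc m x)).2]
    have hge : (Λ^[n] w) 0 + (b m - 2) ≤ (Λ^[n + m] w) 0 := by
      rw [Function.iterate_add_apply]
      refine (congrFun ((hΛ.iterate n).map_add_const (hS w hw) _) 0).symm.trans_le
        ((hΛ.iterate n).mono ((hS w hw).add_const (b m - 2)) (hpw m) (fun x => ?_) 0)
      linarith [(abs_le.1 (hosc m x)).1]
    simp only [hb, abs_le] at *
    constructor <;> linarith
  obtain ⟨ℓ, hℓ⟩ := exists_abs_sub_mul_le hadd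
  have hiter : ∀ n x, ((fun v x => Λ v x + -ℓ)^[n] w) x = (Λ^[n] w) x - n * ℓ := by
    intro n
    induction n with
    | zero => simp
    | succ n ih =>
      intro x
      have : (fun v x => Λ v x + -ℓ)^[n] w = fun x => (Λ^[n] w) x + -(n * ℓ) := by
        ext y
        rw [ih]
        ring
      rw [Function.iterate_succ_apply', this, Function.iterate_succ_apply',
        hΛ.map_add_const (hpw n)]
      push_cast
      ring
  obtain ⟨v, hv, hfix⟩ := (hΛ.add_const (-ℓ)).exists_fixedPoint_of_bounded hS
    (fun v hv => hSadd _ (hSΛ hv) _) hSinf hw (K := 4) (fun n x => by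
      rw [hiter]
      have h1 := abs_le.1 (hosc n x)
      have h2 := abs_le.1 (hℓ n)
      rw [abs_le]
      constructor <;> linarith)
  refine ⟨v, hv, ℓ, ?_⟩
  ext x
  linarith [congrFun hfix x]

end IsLaxOleinik

/-! ### Action of the standard map on differentials of potentials. -/

/-- The potential of the standard map. -/
noncomputable def kickPotential (ε x : ℝ) : ℝ :=
  -(ε / (2 * Real.pi) / (2 * Real.pi)) * Real.cos (2 * Real.pi * x)

theorem hasDerivAt_kickPotential (ε x : ℝ) :
    HasDerivAt (kickPotential ε) (ε / (2 * Real.pi) * Real.sin (2 * Real.pi * x)) x := by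
  have h1 : HasDerivAt (fun x => 2 * Real.pi * x) (2 * Real.pi) x := by
    simpa using (hasDerivAt_id x).const_mul (2 * Real.pi)
  refine (h1.cos.const_mul (-(ε / (2 * Real.pi) / (2 * Real.pi)))).congr_deriv ?_
  field_simp

theorem continuous_kickPotential (ε : ℝ) : Continuous (kickPotential ε) := by
  unfold kickPotential
  fun_prop

theorem periodic_kickPotential (ε : ℝ) : Function.Periodic (kickPotential ε) 1 := fun x => by
  simp only [kickPotential, mul_add, mul_one, Real.cos_add_two_pi]

theorem isLaxOleinik_kick (ε : ℝ) : IsLaxOleinik (step (kickPotential ε)) :=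
  isLaxOleinik_step (continuous_kickPotential ε) (periodic_kickPotential ε)

theorem standardMap_coe (ε x p : ℝ) : standardMap ε ((x : UnitAddCircle), p) =
    (((x + (p + ε / (2 * Real.pi) * Real.sin (2 * Real.pi * x)) : ℝ) : UnitAddCircle),
      p + ε / (2 * Real.pi) * Real.sin (2 * Real.pi * x)) := by
  simp only [standardMap, sinTwoPi_coe, AddCircle.coe_add]

/-- The differential of the envelope lies on the image of the differential of the potential. -/
theorem graph_envelope_subset {c c' ε : ℝ} {w g : ℝ → ℝ} (hw : IsPotential c w)
    (hq : QuasiPeriodic c' (w + g))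
    (hg : ∀ x' x, IsMinimizer (w + g) x' x →
      HasDerivAt g (ε / (2 * Real.pi) * Real.sin (2 * Real.pi * x)) x) :
    graph (envelope (w + g)) ⊆ standardMap ε '' graph w := by
  rintro _ ⟨x', p, hp, rfl⟩
  obtain ⟨x, hx⟩ := hq.exists_isMinimizer x'
  -- At a minimizer `x` the slope of `w` is `x' - x - g' x`, and the slope of the envelope at `x'`
  -- is `x' - x`: the generating-function relations of the standard map.
  refine ⟨_, ⟨x, _, hx.hasDerivAt hw (hg x' x hx), rfl⟩, ?_⟩
  rw [standardMap_coe, hx.eq_of_hasDerivAt hq hp]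
  simp

theorem graph_step_subset {c : ℝ} (ε : ℝ) {w : ℝ → ℝ} (hw : IsPotential c w) :
    graph (step (kickPotential ε) w) ⊆ standardMap ε '' graph w :=
  graph_envelope_subset hw
    (hw.quasiPeriodic_add (continuous_kickPotential ε) (periodic_kickPotential ε))
    fun _ x _ => hasDerivAt_kickPotential ε x

/-- Where the minimum is differentiable, it touches from below whichever function attains it, and
semiconcavity makes that function differentiable with the same slope. -/
theorem graph_inf_subset {c : ℝ} {v w : ℝ → ℝ} (hv : IsPotential c v) (hw : IsPotential c w) :
    graph (v ⊓ w) ⊆ graph v ∪ graph w := by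
  rintro _ ⟨x, p, hp, rfl⟩
  rcases le_total (v x) (w x) with h | h
  · obtain ⟨q, hq⟩ := hv.exists_supergradient x
    exact Or.inl ⟨x, p, hq.hasDerivAt_of_le hp (fun y => min_le_left _ _) (min_eq_left h), rfl⟩
  · obtain ⟨q, hq⟩ := hw.exists_supergradient x
    exact Or.inr ⟨x, p, hq.hasDerivAt_of_le hp (fun y => min_le_right _ _) (min_eq_right h), rfl⟩

theorem graph_add_const (v : ℝ → ℝ) (b : ℝ) : graph (fun x => v x + b) = graph v := by
  ext z
  simp only [graph, hasDerivAt_add_const_iff]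

/-- A minimizer of `v` plus a parabola is a point of differentiability. -/
theorem graph_nonempty {c : ℝ} {v : ℝ → ℝ} (hv : IsPotential c v) : (graph v).Nonempty := by
  have hq := hv.quasiPeriodic_add (V := fun _ => 0) continuous_const (fun _ => rfl)
  obtain ⟨x, hx⟩ := hq.exists_isMinimizer 0
  exact ⟨_, x, _, hx.hasDerivAt hv (hasDerivAt_const x 0), rfl⟩

theorem abs_snd_sub_le_of_mem_graph {c : ℝ} {v : ℝ → ℝ} (hv : IsPotential c v) {z : Cylinder}
    (hz : z ∈ graph v) : |z.2 - c| ≤ 1 / 2 := by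
  obtain ⟨x, p, hp, rfl⟩ := hz
  obtain ⟨q, hq⟩ := hv.exists_supergradient x
  obtain rfl := hq.hasDerivAt_eq hp
  exact hq.abs_sub_le hv.add_one

/-! ### Raising the mean slope by a jump at a point without minimizers. -/

theorem lowerSemicontinuous_ceil_sub (a : ℝ) :
    LowerSemicontinuous fun x : ℝ => ((⌈x - a⌉ : ℤ) : ℝ) := by
  intro x t ht
  have : ∀ᶠ y in 𝓝 x, ((⌈x - a⌉ : ℤ) : ℝ) - 1 < y - a :=
    (continuous_id.sub continuous_const).continuousAt.eventually_const_lt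
      (show (⌈x - a⌉ : ℝ) - 1 < x - a by linarith [Int.ceil_lt_add_one (x - a)])
  filter_upwards [this] with y hy
  refine ht.trans_le ?_
  have : ⌈x - a⌉ - 1 < ⌈y - a⌉ := by
    have := hy.trans_le (Int.le_ceil (y - a))
    exact_mod_cast this
  exact Int.cast_le.2 (Int.sub_one_lt_iff.1 this)

theorem hasDerivAt_ceil_sub {a x : ℝ} (hx : ∀ n : ℤ, x ≠ a + n) :
    HasDerivAt (fun x : ℝ => ((⌈x - a⌉ : ℤ) : ℝ)) 0 x := by
  refine (hasDerivAt_const x ((⌈x - a⌉ : ℤ) : ℝ)).congr_of_eventuallyEq ?_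
  have h1 : x - a < ⌈x - a⌉ := lt_of_le_of_ne (Int.le_ceil _) fun h => hx ⌈x - a⌉ (by linarith)
  have h2 : (⌈x - a⌉ : ℝ) - 1 < x - a := by linarith [Int.ceil_lt_add_one (x - a)]
  have hc : ContinuousAt (fun y => y - a) x := by fun_prop
  filter_upwards [hc.eventually_const_lt h2, hc.eventually_lt_const h1] with y hy1 hy2
  have : ⌈y - a⌉ = ⌈x - a⌉ := Int.ceil_eq_iff.2 ⟨hy1, hy2.le⟩
  rw [this]

/-- The ceiling term jumps up by `ε` at each `a + n` and takes the lower value there. Lower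
semicontinuity, hence existence of minimizers, survives, while the mean slope gains `ε`. -/
theorem IsPotential.quasiPeriodic_ceil {c : ℝ} {w V : ℝ → ℝ} (hw : IsPotential c w)
    (hV : Continuous V) (hV1 : Function.Periodic V 1) (a : ℝ) {ε : ℝ} (hε : 0 ≤ ε) :
    QuasiPeriodic (c + ε) (w + fun x => V x + ε * ⌈x - a⌉) where
  lsc := by
    have h : LowerSemicontinuous fun x : ℝ => ε * (⌈x - a⌉ : ℝ) :=
      Continuous.comp_lowerSemicontinuous (g := fun t => ε * t) (by fun_prop)
        (lowerSemicontinuous_ceil_sub a) (fun s t h => by simp only; gcongr)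
    exact hw.continuous.lowerSemicontinuous.add (hV.lowerSemicontinuous.add h)
  add_one x := by
    have : x + 1 - a = x - a + 1 := by ring
    simp only [Pi.add_apply, hw.add_one, hV1 x, this, Int.ceil_add_one]
    push_cast
    ring

/-- If no minimizer of `v + V` sits at `a`, the same holds for all nearby potentials with a small
jump added at `a`. -/
theorem eventually_not_isMinimizer {V : ℝ → ℝ} (hV : Continuous V) (hV1 : Function.Periodic V 1)
    {C : ℝ} {v : ℝ → ℝ} (hv : v ∈ potentials C) {a : ℝ}
    (ha : ∀ x', ¬ IsMinimizer (v + V) x' a) :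
    ∃ ε₀ > 0, ∀ ε ∈ Ioo 0 ε₀, ∀ᶠ w in 𝓝[potentials C] v, ∀ x',
      ¬ IsMinimizer (w + fun x => V x + ε * ⌈x - a⌉) x' a := by
  have hC : 0 ≤ C := (abs_nonneg _).trans hv.2
  have hq := hv.1.quasiPeriodic_add hV hV1
  set D : ℝ → ℝ := fun x' => v a + V a + (x' - a) ^ 2 / 2 - envelope (v + V) x' with hD
  have hDc : Continuous D := by
    have := hq.isPotential_envelope.continuous
    fun_prop
  have hDpos : ∀ x', 0 < D x' := by
    intro x'
    by_contra! hle
    exact ha x' fun y => by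
      have := hq.envelope_le x' y
      simp only [hD, Pi.add_apply] at *
      linarith
  obtain ⟨x₁, -, hx₁⟩ := (isCompact_Icc (a := a - (C + 2)) (b := a + (C + 2))).exists_isMinOn
    (nonempty_Icc.2 (by linarith)) hDc.continuousOn
  set η := D x₁ with hη
  have hη0 : 0 < η := hDpos x₁
  -- `η` is the least loss from using `a` as minimizer, for the `x'` that could have `a` as
  -- minimizer. The jump term at a true minimizer `x₀` is at most `ε * (2 * C + 4) < η / 2`, and
  -- replacing `v` by `w` costs `η / 8` twice, so `a` still loses.
  refine ⟨min 1 (η / (2 * (2 * C + 4))), by positivity, fun ε hε => ?_⟩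
  have hε1 : ε < 1 := hε.2.trans_le (min_le_left _ _)
  have hε2 : ε * (2 * (2 * C + 4)) < η :=
    (lt_div_iff₀ (by positivity)).1 (hε.2.trans_le (min_le_right _ _))
  filter_upwards [eventually_abs_sub_le hv (|a| + 2 * C + 3) (show 0 < η / 8 by positivity),
    self_mem_nhdsWithin] with w hw hwC x' hmin
  have h1 := abs_le.1 (hmin.abs_sub_le (hwC.1.quasiPeriodic_ceil hV hV1 a hε.1.le))
  have h2 := abs_le.1 hwC.2
  obtain ⟨x₀, hx₀⟩ := hq.exists_isMinimizer x'
  have h3 := abs_le.1 (hx₀.abs_sub_le hq)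
  have h4 := abs_le.1 hv.2
  have hx' : x' ∈ Icc (a - (C + 2)) (a + (C + 2)) :=
    ⟨by linarith [hε.1], by linarith [hε.1]⟩
  have h5 : η ≤ D x' := hx₁ hx'
  have h6 := hmin x₀
  simp only [Pi.add_apply, sub_self, Int.ceil_zero, Int.cast_zero, mul_zero, add_zero] at h6
  have h7 := hx₀.envelope_eq
  simp only [Pi.add_apply] at h7
  have hceil : (⌈x₀ - a⌉ : ℝ) ≤ 2 * C + 4 := by
    have := Int.ceil_lt_add_one (x₀ - a)
    linarith [hx'.1, hx'.2]
  have h8 : ε * (⌈x₀ - a⌉ : ℝ) ≤ ε * (2 * C + 4) := by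
    have := hε.1.le
    gcongr
  have ha1 := neg_abs_le a
  have ha2 := le_abs_self a
  have h9 := abs_le.1 (hw a ⟨by linarith, by linarith⟩)
  have h10 := abs_le.1 (hw x₀ ⟨by linarith [hx'.1, hx'.2], by linarith [hx'.1, hx'.2]⟩)
  simp only [hD] at h5
  linarith

/-- Adding a small jump at a point where no minimizer sits raises the mean slope, and the
differential of the new envelope still comes from the differential of the old potential. -/
theorem eventually_graph_envelope_subset (κ : ℝ) {C : ℝ} {v : ℝ → ℝ} (hv : v ∈ potentials C)
    {a : ℝ} (ha : ∀ x', ¬ IsMinimizer (v + kickPotential κ) x' a) :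
    ∃ ε₀ > 0, ∀ ε ∈ Ioo 0 ε₀, ∀ᶠ w in 𝓝[potentials C] v, ∃ u,
      IsPotential (w 1 - w 0 + ε) u ∧ graph u ⊆ standardMap κ '' graph w := by
  have hV := continuous_kickPotential κ
  have hV1 := periodic_kickPotential κ
  obtain ⟨ε₀, hε₀, h⟩ := eventually_not_isMinimizer hV hV1 hv ha
  refine ⟨ε₀, hε₀, fun ε hε => ?_⟩
  filter_upwards [h ε hε, self_mem_nhdsWithin] with w hw hwC
  have hq := hwC.1.quasiPeriodic_ceil hV hV1 a hε.1.le
  refine ⟨_, hq.isPotential_envelope, graph_envelope_subset hwC.1 hq fun x' x hx => ?_⟩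
  -- By periodicity, a minimizer at `a + n` would translate to one at `a`.
  have hxa : ∀ n : ℤ, x ≠ a + n := by
    rintro n rfl
    refine hw (x' + (-n : ℤ)) ?_
    have := hx.add_int hq.add_one (-n)
    rwa [show a + n + ((-n : ℤ) : ℝ) = a by push_cast; ring] at this
  refine ((hasDerivAt_kickPotential κ x).add
    ((hasDerivAt_ceil_sub hxa).const_mul ε)).congr_deriv ?_
  ring

/-! ### From potentials without hidden points to essential invariant circles. -/

section

/-- Lifting a nullhomotopy would give a continuous section `s` of `ℝ → ℝ/ℤ`; then `s t - t` is
constant although `s` is 1-periodic in `t`. -/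
theorem not_nullhomotopic_id_circle : ¬ (ContinuousMap.id UnitAddCircle).Nullhomotopic := by
  rintro ⟨y, ⟨H⟩⟩
  obtain ⟨e, rfl⟩ := QuotientAddGroup.mk_surjective y
  have cov := AddCircle.isCoveringMap_coe (1 : ℝ)
  have h0 : ∀ x, H.symm.toContinuousMap (0, x) = ((ContinuousMap.const UnitAddCircle e) x : ℝ) :=
    fun x => H.symm.apply_zero x
  let s : UnitAddCircle → ℝ := fun x => cov.liftHomotopy _ _ h0 (1, x)
  have hs : Continuous s := (ContinuousMap.continuous _).comp (Continuous.prodMk_right 1)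
  have hsx : ∀ x, (s x : UnitAddCircle) = x := fun x =>
    (congrFun (cov.liftHomotopy_lifts _ _ h0) (1, x)).trans (H.symm.apply_one x)
  have hc := const_of_forall_int (f := fun t : ℝ => s t - t)
    ((hs.comp (AddCircle.continuous_mk' 1)).sub continuous_id)
    (fun t => coe_eq_coe_iff_exists_int.1 (hsx t)) (0 + 1) 0
  simp only [coe_add_one] at hc
  linarith

theorem IsPotential.isSupergradient_deriv {c : ℝ} {v : ℝ → ℝ} (hv : IsPotential c v) {x : ℝ}
    (hd : DifferentiableAt ℝ v x) : IsSupergradient v x (deriv v x) := by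
  obtain ⟨p, hp⟩ := hv.exists_supergradient x
  rwa [hp.hasDerivAt_eq hd.hasDerivAt]

/-- A differentiable semiconcave potential is continuously differentiable. -/
theorem IsPotential.continuous_deriv {c : ℝ} {v : ℝ → ℝ} (hv : IsPotential c v)
    (hd : Differentiable ℝ v) : Continuous (deriv v) := by
  refine continuous_iff_continuousAt.2 fun x => continuousAt_iff_ultrafilter.2 fun u hu => ?_
  have hmem : ∀ y, deriv v y ∈ Icc (c - 1 / 2) (c + 1 / 2) := fun y => by
    have := abs_le.1 ((hv.isSupergradient_deriv (hd y)).abs_sub_le hv.add_one)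
    constructor <;> linarith
  -- Derivatives are bounded supergradients, and a limit of supergradients is a supergradient at
  -- `x`, where the only one is the derivative.
  obtain ⟨p, -, hp⟩ := isCompact_Icc.ultrafilter_le_nhds (u.map (deriv v))
    (le_principal_iff.2 (Ultrafilter.mem_map.2 (univ_mem' hmem)))
  have hp' : Tendsto (deriv v) u (𝓝 p) := hp
  have hs : IsSupergradient v x p :=
    isSupergradient_of_tendsto (l := u) (w := fun _ => v) (fun _ => tendsto_const_nhds)
      ((hv.continuous.tendsto x).mono_left hu) (show Tendsto (fun y : ℝ => y) u (𝓝 x) from hu) hp'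
      (Eventually.of_forall fun y => hv.isSupergradient_deriv (hd y))
  rwa [hs.hasDerivAt_eq (hd x).hasDerivAt]

/-- The graph of the derivative of a differentiable potential is an essential circle. -/
theorem IsPotential.exists_essential_loop {c : ℝ} {v : ℝ → ℝ} (hv : IsPotential c v)
    (hd : Differentiable ℝ v) : ∃ γ : C(UnitAddCircle, Cylinder),
      Function.Injective γ ∧ range γ = graph v ∧ ¬ γ.Nullhomotopic := by
  have hper : Function.Periodic (deriv v) 1 := fun x => by
    rw [← deriv_comp_add_const]
    simp only [hv.add_one, deriv_add_const]
  let γ : C(UnitAddCircle, Cylinder) := ⟨fun x => (x, hper.lift x),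
    continuous_id.prodMk (continuous_periodic_lift (hv.continuous_deriv hd) hper)⟩
  have hγ : ∀ t : ℝ, γ t = ((t : UnitAddCircle), deriv v t) := fun t =>
    Prod.ext rfl (hper.lift_coe t)
  refine ⟨γ, fun x y h => congrArg Prod.fst h, ?_, fun h => ?_⟩
  · ext z
    constructor
    · rintro ⟨x, rfl⟩
      obtain ⟨t, rfl⟩ := QuotientAddGroup.mk_surjective x
      exact ⟨t, _, (hd t).hasDerivAt, hγ t⟩
    · rintro ⟨x, p, hp, rfl⟩
      exact ⟨(x : UnitAddCircle), by rw [hγ, hp.deriv]⟩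
  · exact not_nullhomotopic_id_circle (h.comp_right ⟨Prod.fst, continuous_fst⟩)

theorem IsPotential.differentiable_of_forall_isMinimizer {c κ : ℝ} {v : ℝ → ℝ}
    (hv : IsPotential c v) (h : ∀ x, ∃ x', IsMinimizer (v + kickPotential κ) x' x) :
    Differentiable ℝ v := fun x => by
  obtain ⟨x', hx⟩ := h x
  exact (hx.hasDerivAt hv (hasDerivAt_kickPotential κ x)).differentiableAt

/-- For the reverse inclusion, each `x` is a minimizer for some `x'`, and differentiability at `x'`
identifies the slope there as `x' - x`. -/
theorem IsPotential.image_graph_eq {c κ : ℝ} {v : ℝ → ℝ} (hv : IsPotential c v)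
    (h : ∀ x, ∃ x', IsMinimizer (v + kickPotential κ) x' x)
    (hd : Differentiable ℝ (step (kickPotential κ) v)) :
    standardMap κ '' graph v = graph (step (kickPotential κ) v) := by
  refine Subset.antisymm ?_ (graph_step_subset κ hv)
  rintro _ ⟨_, ⟨x, p, hp, rfl⟩, rfl⟩
  obtain ⟨x', hx⟩ := h x
  have hp' := hp.unique (hx.hasDerivAt hv (hasDerivAt_kickPotential κ x))
  refine ⟨x', x' - x, ?_, ?_⟩
  · have := (hd x').hasDerivAt
    rwa [hx.eq_of_hasDerivAt (hv.quasiPeriodic_add (continuous_kickPotential κ)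
      (periodic_kickPotential κ)) this] at this
  · rw [standardMap_coe, hp']
    simp

variable {κ₁ κ₂ : ℝ}

/-- A fixed point of the Lax–Oleinik semigroup all of whose points start minimizers gives an
essential invariant circle. -/
theorem IsPotential.exists_isEssentialInvariantCircle {c ℓ : ℝ} {v : ℝ → ℝ}
    (hv : IsPotential c v)
    (hfix : step (kickPotential κ₂) (step (kickPotential κ₁) v) = fun x => v x + ℓ)
    (h₁ : ∀ x, ∃ x', IsMinimizer (v + kickPotential κ₁) x' x)
    (h₂ : ∀ x, ∃ x', IsMinimizer (step (kickPotential κ₁) v + kickPotential κ₂) x' x) :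
    ∃ C, IsEssentialInvariantCircle (T κ₁ κ₂) C := by
  have hv₁ := (isLaxOleinik_kick κ₁).isPotential hv
  have hd := hv.differentiable_of_forall_isMinimizer h₁
  have hd₁ := hv₁.differentiable_of_forall_isMinimizer h₂
  refine ⟨graph v, hv.exists_essential_loop hd, ?_⟩
  rw [T_eq_standardMap_comp, image_comp, hv.image_graph_eq h₁ hd₁, hv₁.image_graph_eq h₂, hfix,
    graph_add_const]
  rw [hfix]
  exact hd.add_const ℓ

/-! ### Reachable potentials and their mean slopes. -/

/-- The differential of `w` is reached from the differential of `v` in a bounded time. -/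
def Reaches (κ₁ κ₂ : ℝ) (v w : ℝ → ℝ) : Prop :=
  ∃ N : ℕ, ∀ z ∈ graph w, ∃ n ≤ N, ∃ z₀ ∈ graph v, (T κ₁ κ₂)^[n] z₀ = z

namespace Reaches

variable {v w u : ℝ → ℝ}

theorem refl (v : ℝ → ℝ) : Reaches κ₁ κ₂ v v := ⟨0, fun z hz => ⟨0, le_rfl, z, hz, rfl⟩⟩

theorem image (h : Reaches κ₁ κ₂ v w) (hu : graph u ⊆ T κ₁ κ₂ '' graph w) :
    Reaches κ₁ κ₂ v u := by
  obtain ⟨N, hN⟩ := h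
  refine ⟨N + 1, fun z hz => ?_⟩
  obtain ⟨z', hz', rfl⟩ := hu hz
  obtain ⟨n, hn, z₀, hz₀, rfl⟩ := hN z' hz'
  exact ⟨n + 1, by omega, z₀, hz₀, Function.iterate_succ_apply' _ _ _⟩

theorem inf {c : ℝ} (hw : IsPotential c w) (hu : IsPotential c u) (h : Reaches κ₁ κ₂ v w)
    (h' : Reaches κ₁ κ₂ v u) : Reaches κ₁ κ₂ v (w ⊓ u) := by
  obtain ⟨N, hN⟩ := h
  obtain ⟨M, hM⟩ := h'
  refine ⟨max N M, fun z hz => ?_⟩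
  rcases graph_inf_subset hw hu hz with hz | hz
  · obtain ⟨n, hn, h⟩ := hN z hz
    exact ⟨n, hn.trans (le_max_left _ _), h⟩
  · obtain ⟨n, hn, h⟩ := hM z hz
    exact ⟨n, hn.trans (le_max_right _ _), h⟩

theorem add_const (h : Reaches κ₁ κ₂ v w) (b : ℝ) : Reaches κ₁ κ₂ v (fun x => w x + b) := by
  obtain ⟨N, hN⟩ := h
  exact ⟨N, fun z hz => hN z (by rwa [graph_add_const] at hz)⟩

theorem step_of_subset {c : ℝ} (h : Reaches κ₁ κ₂ v w) (hu : IsPotential c u)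
    (hs : graph u ⊆ standardMap κ₁ '' graph w) :
    Reaches κ₁ κ₂ v (step (kickPotential κ₂) u) := by
  refine h.image ?_
  rw [T_eq_standardMap_comp, image_comp]
  exact (graph_step_subset κ₂ hu).trans (image_mono hs)

theorem of_subset_step {c : ℝ} (h : Reaches κ₁ κ₂ v w) (hw : IsPotential c w)
    (hs : graph u ⊆ standardMap κ₂ '' graph (step (kickPotential κ₁) w)) :
    Reaches κ₁ κ₂ v u := by
  refine h.image ?_
  rw [T_eq_standardMap_comp, image_comp]
  exact hs.trans (image_mono (graph_step_subset κ₁ hw))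

end Reaches

/-- The fixed points of the semigroup in the closure of the reachable potentials of slope `c`. -/
theorem exists_weakKAM_reaches {c : ℝ} {v₀ : ℝ → ℝ}
    (hne : ∃ w, IsPotential c w ∧ Reaches κ₁ κ₂ v₀ w) :
    ∃ v ∈ closure {w | IsPotential c w ∧ Reaches κ₁ κ₂ v₀ w}, v 0 = 0 ∧
      ∀ x, step (kickPotential κ₂) (step (kickPotential κ₁) v) x - v x =
        step (kickPotential κ₂) (step (kickPotential κ₁) v) 0 - v 0 := by
  have hΛ := (isLaxOleinik_kick κ₂).comp (isLaxOleinik_kick κ₁)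
  have hS : ∀ w ∈ {w | IsPotential c w ∧ Reaches κ₁ κ₂ v₀ w}, IsPotential c w := fun w hw => hw.1
  obtain ⟨v, hv, ℓ, hfix⟩ := hΛ.exists_weakKAM hS
    (fun w hw => ⟨hΛ.isPotential hw.1, hw.2.step_of_subset
      ((isLaxOleinik_kick κ₁).isPotential hw.1) (graph_step_subset κ₁ hw.1)⟩)
    (fun v hv w hw => ⟨hv.1.inf hw.1, hv.2.inf hv.1 hw.1 hw.2⟩)
    (fun v hv b => ⟨hv.1.add_const b, hv.2.add_const b⟩) hne
  have hpot : IsPotential c v := closure_minimal hS (isClosed_isPotential c) hv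
  have hfix' := hΛ.map_add_const hpot (-v 0)
  rw [hfix] at hfix'
  simp only [Function.comp_apply] at hfix'
  refine ⟨fun x => v x + -v 0, map_mem_closure (f := fun w : ℝ → ℝ => fun x => w x + -v 0)
    (by fun_prop) hv fun w hw => ⟨hw.1.add_const _, hw.2.add_const _⟩, by simp, fun x => ?_⟩
  rw [hfix']
  ring

/-- In the absence of essential invariant circles, potentials of arbitrarily large mean slope are
reached. -/
theorem exists_reaches_of_not_exists (hno : ¬ ∃ C, IsEssentialInvariantCircle (T κ₁ κ₂) C)
    {c₀ : ℝ} {v₀ : ℝ → ℝ} (hv₀ : IsPotential c₀ v₀) (B : ℝ) :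
    ∃ c w, B ≤ c ∧ IsPotential c w ∧ Reaches κ₁ κ₂ v₀ w := by
  by_contra! hcon
  set A : Set ℝ := {c | ∃ w, IsPotential c w ∧ Reaches κ₁ κ₂ v₀ w} with hA
  have hAbdd : BddAbove A := by
    refine ⟨B, ?_⟩
    rintro c ⟨w, hw, hr⟩
    by_contra! hlt
    exact hcon c w hlt.le hw hr
  obtain ⟨u, humono, hutend, huA⟩ :=
    exists_seq_tendsto_sSup (show A.Nonempty from ⟨c₀, v₀, hv₀, Reaches.refl v₀⟩) hAbdd
  set s := sSup A with hs
  set C := max |u 0| |s| with hC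
  have huC : ∀ k, |u k| ≤ C := fun k => by
    rw [hC]
    exact abs_le_max_abs_abs (humono (Nat.zero_le k)) (le_csSup hAbdd (huA k))
  set R := {w | w ∈ potentials C ∧ Reaches κ₁ κ₂ v₀ w} with hR
  have hLO₁ := isLaxOleinik_kick κ₁
  have hLO₂ := isLaxOleinik_kick κ₂
  have hΛ := hLO₂.comp hLO₁
  choose v hvcl hv0 hvfix using fun k => exists_weakKAM_reaches (huA k)
  have hvpot : ∀ k, IsPotential (u k) (v k) := fun k =>
    closure_minimal (fun w hw => hw.1) (isClosed_isPotential (u k)) (hvcl k)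
  have hsub : ∀ k, {w | IsPotential (u k) w ∧ Reaches κ₁ κ₂ v₀ w} ⊆ R := fun k w hw =>
    ⟨hw.1.mem_potentials (huC k), hw.2⟩
  have hvR : ∀ k, v k ∈ closure R := fun k => closure_mono (hsub k) (hvcl k)
  have hvC : ∀ k, v k ∈ potentials C := fun k => (hvpot k).mem_potentials (huC k)
  obtain ⟨V, ⟨hVC, -⟩, hVcl⟩ := (isCompact_potentials C).exists_mapClusterPt (f := atTop) (u := v)
    (le_principal_iff.2 (mem_map.2 (univ_mem' fun k => ⟨hvC k, hv0 k⟩)))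
  obtain ⟨U, hU, hUV⟩ := mapClusterPt_iff_ultrafilter.1 hVcl
  have hVR : V ∈ closure R :=
    closure_closure.subset (mem_closure_of_tendsto hUV (Eventually.of_forall hvR))
  have hVs : V 1 - V 0 = s := by
    refine tendsto_nhds_unique ((tendsto_pi_nhds.1 hUV 1).sub (tendsto_pi_nhds.1 hUV 0)) ?_
    exact (hutend.mono_left hU).congr fun k => (hvpot k).eq_sub
  have hVpot : IsPotential s V := hVs ▸ hVC.1
  have hVfix : step (kickPotential κ₂) (step (kickPotential κ₁) V) = fun x => V x +
      (step (kickPotential κ₂) (step (kickPotential κ₁) V) 0 - V 0) := by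
    ext x
    have ht := hΛ.tendsto hvC hVC hUV
    have := tendsto_nhds_unique_of_eventuallyEq
      ((tendsto_pi_nhds.1 ht x).sub (tendsto_pi_nhds.1 hUV x))
      ((tendsto_pi_nhds.1 ht 0).sub (tendsto_pi_nhds.1 hUV 0))
      (Eventually.of_forall fun k => hvfix k x)
    simp only [Function.comp_apply] at this
    linarith
  have hle : ∀ c w, IsPotential c w → Reaches κ₁ κ₂ v₀ w → c ≤ s := fun c w hw hr =>
    le_csSup hAbdd ⟨w, hw, hr⟩
  have hnebot : (𝓝[R] V).NeBot := mem_closure_iff_nhdsWithin_neBot.1 hVR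
  have hRC : 𝓝[R] V ≤ 𝓝[potentials C] V := nhdsWithin_mono _ fun w hw => hw.1
  have hslope : ∀ ε > 0, ∀ᶠ w in 𝓝[R] V, s < w 1 - w 0 + ε := by
    intro ε hε
    have : Tendsto (fun w : ℝ → ℝ => w 1 - w 0 + ε) (𝓝[R] V) (𝓝 (V 1 - V 0 + ε)) :=
      ((by fun_prop : Continuous fun w : ℝ → ℝ => w 1 - w 0 + ε).tendsto V).mono_left
        nhdsWithin_le_nhds
    exact this.eventually_const_lt (by linarith)
  by_cases h₁ : ∀ x, ∃ x', IsMinimizer (V + kickPotential κ₁) x' x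
  · by_cases h₂ : ∀ x, ∃ x', IsMinimizer (step (kickPotential κ₁) V + kickPotential κ₂) x' x
    · exact hno (hVpot.exists_isEssentialInvariantCircle hVfix h₁ h₂)
    · push Not at h₂
      obtain ⟨a, ha⟩ := h₂
      obtain ⟨ε₀, hε₀, h⟩ := eventually_graph_envelope_subset κ₂ (hLO₁.mapsTo C hVC) ha
      have ht : Tendsto (step (kickPotential κ₁)) (𝓝[R] V)
          (𝓝[potentials C] (step (kickPotential κ₁) V)) :=
        ((hLO₁.continuousOn C V hVC).tendsto_nhdsWithin (hLO₁.mapsTo C)).mono_left hRC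
      obtain ⟨w, ⟨u', hu', hg⟩, hlt, hwR⟩ := ((ht.eventually (h (ε₀ / 2)
        ⟨by linarith, by linarith⟩)).and ((hslope (ε₀ / 2) (by linarith)).and
          self_mem_nhdsWithin)).exists
      have := hle _ _ hu' (hwR.2.of_subset_step hwR.1.1 hg)
      rw [← (hLO₁.isPotential hwR.1.1).eq_sub] at this
      linarith
  · push Not at h₁
    obtain ⟨a, ha⟩ := h₁
    obtain ⟨ε₀, hε₀, h⟩ := eventually_graph_envelope_subset κ₁ hVC ha
    obtain ⟨w, ⟨u', hu', hg⟩, hlt, hwR⟩ := (((h (ε₀ / 2)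
      ⟨by linarith, by linarith⟩).filter_mono hRC).and ((hslope (ε₀ / 2) (by linarith)).and
        self_mem_nhdsWithin)).exists
    have := hle _ _ (hLO₂.isPotential hu') (hwR.2.step_of_subset hu' hg)
    linarith

/-- A point whose orbit follows a given sequence of successively reached potentials. -/
theorem exists_orbit_of_reaches {c : ℕ → ℝ} {v : ℕ → ℝ → ℝ} (hv : ∀ k, IsPotential (c k) (v k))
    (hr : ∀ k, Reaches κ₁ κ₂ (v k) (v (k + 1))) :
    ∃ z, ∀ k, ∃ n, c k - 1 / 2 ≤ ((T κ₁ κ₂)^[n] z).2 := by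
  choose N hN using hr
  let M : ℕ → ℕ := fun k => ∑ i ∈ Finset.range k, N i
  have hM : ∀ k, M (k + 1) = M k + N k := fun k => Finset.sum_range_succ _ _
  have hback : ∀ k, ∀ z ∈ graph (v k), ∃ z₀ ∈ graph (v 0), (∃ n ≤ M k, (T κ₁ κ₂)^[n] z₀ = z) ∧
      ∀ j ≤ k, ∃ n ≤ M j, (T κ₁ κ₂)^[n] z₀ ∈ graph (v j) := by
    intro k
    induction k with
    | zero =>
      refine fun z hz => ⟨z, hz, ⟨0, Nat.zero_le _, rfl⟩, fun j hj => ⟨0, Nat.zero_le _, ?_⟩⟩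
      obtain rfl : j = 0 := by omega
      exact hz
    | succ k ih =>
      intro z hz
      obtain ⟨n, hn, z', hz', hzz⟩ := hN k z hz
      obtain ⟨z₀, hz₀, ⟨m, hm, hmz⟩, hj⟩ := ih z' hz'
      have hnm : (T κ₁ κ₂)^[n + m] z₀ = z := by rw [Function.iterate_add_apply, hmz, hzz]
      have hle : n + m ≤ M (k + 1) := by rw [hM]; omega
      refine ⟨z₀, hz₀, ⟨n + m, hle, hnm⟩, fun j hjk => ?_⟩
      rcases Nat.lt_or_ge k j with h | h
      · obtain rfl : j = k + 1 := by omega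
        exact ⟨n + m, hle, by rwa [hnm]⟩
      · exact hj j h
  let F : ℕ → Set Cylinder := fun k => (univ ×ˢ Icc (c 0 - 1 / 2) (c 0 + 1 / 2)) ∩
    ⋂ j ∈ Iic k, ⋃ n ∈ Iic (M j), {z | c j - 1 / 2 ≤ ((T κ₁ κ₂)^[n] z).2}
  have hclosed : ∀ k, IsClosed (F k) := fun k => by
    refine (isClosed_univ.prod isClosed_Icc).inter (isClosed_biInter fun j _ =>
      (finite_Iic (M j)).isClosed_biUnion fun n _ => isClosed_le continuous_const ?_)
    exact continuous_snd.comp ((continuous_T κ₁ κ₂).iterate n)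
  have hcomp : IsCompact (F 0) :=
    (isCompact_univ.prod isCompact_Icc).of_isClosed_subset (hclosed 0) inter_subset_left
  have hne : ∀ k, (F k).Nonempty := fun k => by
    obtain ⟨z, hz⟩ := graph_nonempty (hv k)
    obtain ⟨z₀, hz₀, -, hj⟩ := hback k z hz
    have h0 := abs_le.1 (abs_snd_sub_le_of_mem_graph (hv 0) hz₀)
    refine ⟨z₀, ⟨mem_univ _, by linarith, by linarith⟩, mem_iInter₂.2 fun j hjk => ?_⟩
    obtain ⟨n, hn, hg⟩ := hj j hjk
    have h1 := abs_le.1 (abs_snd_sub_le_of_mem_graph (hv j) hg)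
    exact mem_iUnion₂.2 ⟨n, hn, show c j - 1 / 2 ≤ ((T κ₁ κ₂)^[n] z₀).2 by linarith⟩
  obtain ⟨z, hz⟩ := IsCompact.nonempty_iInter_of_sequence_nonempty_isCompact_isClosed F
    (fun k => inter_subset_inter_right _
      (biInter_subset_biInter_left (Iic_subset_Iic.2 (Nat.le_succ k)))) hne hcomp hclosed
  refine ⟨z, fun k => ?_⟩
  obtain ⟨n, -, hn⟩ := mem_iUnion₂.1 (mem_iInter₂.1 (mem_iInter.1 hz k).2 k self_mem_Iic)
  exact ⟨n, hn⟩

theorem hasGlobalTransport_of_not_exists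
    (hno : ¬ ∃ C, IsEssentialInvariantCircle (T κ₁ κ₂) C) : HasGlobalTransport (T κ₁ κ₂) := by
  have hnext : ∀ s : {s : ℝ × (ℝ → ℝ) // IsPotential s.1 s.2},
      ∃ s' : {s : ℝ × (ℝ → ℝ) // IsPotential s.1 s.2},
        s.1.1 + 1 ≤ s'.1.1 ∧ Reaches κ₁ κ₂ s.1.2 s'.1.2 := by
    rintro ⟨⟨c, v⟩, hv⟩
    obtain ⟨c', w, hc, hw, hr⟩ := exists_reaches_of_not_exists hno hv (c + 1)
    exact ⟨⟨⟨c', w⟩, hw⟩, hc, hr⟩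
  choose f hf hr using hnext
  have hzero : IsPotential 0 (fun _ => 0) :=
    ⟨fun _ => by simp, fun _ => ⟨0, fun y => by simpa using by positivity⟩⟩
  let σ : ℕ → {s : ℝ × (ℝ → ℝ) // IsPotential s.1 s.2} := fun k => f^[k] ⟨⟨0, _⟩, hzero⟩
  have hσ : ∀ k, σ (k + 1) = f (σ k) := fun k => Function.iterate_succ_apply' _ _ _
  have hge : ∀ k : ℕ, (k : ℝ) ≤ (σ k).1.1 := by
    intro k
    induction k with
    | zero => simp [σ]
    | succ k ih =>
      rw [hσ]
      push_cast
      linarith [hf (σ k)]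
  obtain ⟨z, hz⟩ := exists_orbit_of_reaches (fun k => (σ k).2)
    (fun k => by rw [hσ]; exact hr (σ k))
  refine ⟨z, fun hb => ?_⟩
  obtain ⟨b, hb⟩ := hb.bddAbove
  obtain ⟨k, hk⟩ := exists_nat_gt (b + 1 / 2)
  obtain ⟨n, hn⟩ := hz k
  have := hb (mem_range_self n)
  linarith [hge k]

end

end NASM

theorem proposition1 (κ₁ κ₂ : ℝ)
    (hA : ∀ C : Set NASM.Cylinder,
      NASM.IsEssentialInvariantCircle (NASM.T κ₁ κ₂) C → NASM.amplitude C < 1)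
    (hO : ∃ (x₀ : UnitAddCircle) (y₀ : ℝ), 0 < y₀ ∧ y₀ < 1 ∧
      ∃ n : ℕ, 2 < |((NASM.T κ₁ κ₂)^[n] (x₀, y₀)).2 - y₀|) :
    (¬ ∃ C : Set NASM.Cylinder, NASM.IsEssentialInvariantCircle (NASM.T κ₁ κ₂) C) ∧
      NASM.HasGlobalTransport (NASM.T κ₁ κ₂) := by
  have hno : ¬ ∃ C : Set NASM.Cylinder, NASM.IsEssentialInvariantCircle (NASM.T κ₁ κ₂) C := by
    rintro ⟨C, hC⟩
    obtain ⟨x₀, y₀, -, -, n, hn⟩ := hO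
    exact (NASM.abs_iterate_snd_sub_le hC (hA C hC) (x₀, y₀) n).not_gt hn
  exact ⟨hno, NASM.hasGlobalTransport_of_not_exists hno⟩
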